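/- **Theorem (Asymptotic distribution for the Adaptive Transfer Lasso).** Setting. Let $y = X\beta^* + \varepsilon$ with a deterministic design $X = X_n \in \mathbb{R}^{n\times p}$ ($p$ fixed, rows $x_1,\dots,x_n$), $\beta^*\in\mathbb{R}^p$, and $\varepsilon_1,\dots,\varepsilon_n$ i.i.d. $\mathcal N(0,\sigma^2)$. Assume $\frac1n X^\top X \to C \succ O$ and $\frac1n\max_i\|x_i\|_2^2\to 0$ as $n\to\infty$. Put $S=\{j:\beta^*_j\ne 0\}$ and $S^c=\{j:\beta^*_j=0\}$. Let $m=m_n$ be positive integers with $n/m\to r_0\ge 0$, and let $\tilde\beta=\tilde\beta_n$ be a random vector, independent of $\varepsilon$, such that $\sqrt m(\tilde\beta-\beta^*)$ converges in distribution to a random vector $z$. Let $W\sim\mathcal N(0,\sigma^2C)$ be independent of $z$. For $\gamma_1,\gamma_2\ge 0$ and $\lambda_n,\eta_n\ge 0$ let $$\hat\beta_n \in \operatorname*{argmin}_{\beta\in\mathbb{R}^p}\Big\{\tfrac1n\|y-X\beta\|_2^2+\tfrac{\lambda_n}{n}\sum_j\frac{|\beta_j|}{|\tilde\beta_j|^{\gamma_1}}+\tfrac{\eta_n}{n}\sum_j|\tilde\beta_j|^{\gamma_2}|\beta_j-\tilde\beta_j|\Big\}$$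 be a measurable choice of minimizer, with the conventions $1/0=\infty$, $\infty\cdot 0=0$ and $0^0=1$. Consider the condition (N) $P(z_j=0)=0$ for every $j\in S^c$. Then the following hold as $n\to\infty$; in (iii)–(vi) the minimizers on the right-hand sides exist and are unique (almost surely). (i) If $\eta_n/\sqrt{nm^{\gamma_2}}\to\infty$ and $\sqrt{m^{\gamma_1+\gamma_2}}\,\lambda_n/\eta_n\to 0$, and if (N) holds or $\gamma_2=0$, then $\sqrt m(\hat\beta_n-\beta^*)\overset{d}{\to}z$. (ii) If $\sqrt{m^{\gamma_1}/n}\,\lambda_n\to\infty$, $\eta_n/\sqrt n\to\infty$, $\eta_n/\lambda_n\to\infty$, $\eta_n/(\sqrt{m^{\gamma_1+\gamma_2}}\,\lambda_n)\to0$ and $\sqrt{m^{\gamma_1}}\lambda_n/\eta_n\to\rho_0\in[0,\infty]$, then $\sqrt m(\hat\beta_n-\beta^*)\overset{d}{\to}\bar z$, where $\bar z_j=z_j$ for $j\in S$ and $\bar z_j=0$ for $j\in S^c$. (iii) If $\sqrt{m^{\gamma_1}/n}\,\lambda_n\to\lambda_1\ge0$ and $\eta_n/\sqrt n\to\eta_0\ge0$,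 where $\lambda_1=0$ in case $\gamma_1=0$ and $\eta_0=0$ in case $\gamma_2=0$, and if (N) holds or $\gamma_1=0$, then $$\sqrt n(\hat\beta_n-\beta^*)\overset{d}{\to}\operatorname*{argmin}_{u}\Big\{u^\top Cu-2u^\top W+\sum_{j\in S^c}\frac{\lambda_1}{|z_j|^{\gamma_1}}|u_j|+\sum_{j\in S}\eta_0|\beta^*_j|^{\gamma_2}|u_j-\sqrt{r_0}z_j|\Big\}.$$ (iv) If $\sqrt{m^{\gamma_1}/n}\,\lambda_n\to\lambda_1\ge0$, $\eta_n/\sqrt n\to\infty$ and $\eta_n/\sqrt{nm^{\gamma_2}}\to\eta_1\ge0$, and if (N) holds or $\gamma_1=0$, then $$\sqrt n(\hat\beta_n-\beta^*)\overset{d}{\to}\operatorname*{argmin}_{u:\,u_S=\sqrt{r_0}z_S}\Big\{u^\top Cu-2u^\top W+\sum_{j\in S^c}\Big(\frac{\lambda_1}{|z_j|^{\gamma_1}}|u_j|+\eta_1|z_j|^{\gamma_2}|u_j-\sqrt{r_0}z_j|\Big)\Big\}.$$ (v) If $\sqrt{m^{\gamma_1}/n}\,\lambda_n\to\infty$, $\lambda_n/\sqrt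 n\to\lambda_0\ge0$ and $\eta_n/\sqrt n\to\eta_0\ge0$, then $$\sqrt n(\hat\beta_n-\beta^*)\overset{d}{\to}\operatorname*{argmin}_{u:\,u_{S^c}=0}\Big\{u^\top Cu-2u^\top W+\sum_{j\in S}\Big(\lambda_0\frac{\operatorname{sgn}(\beta^*_j)}{|\beta^*_j|^{\gamma_1}}u_j+\eta_0|\beta^*_j|^{\gamma_2}|u_j-\sqrt{r_0}z_j|\Big)\Big\}.$$ (vi) If $\gamma_1>0$, $\lambda_n/\sqrt n\to\infty$, $\lambda_n/n\to0$ and $\eta_n/\lambda_n\to0$, then $$\frac{n}{\lambda_n}(\hat\beta_n-\beta^*)\overset{d}{\to}\operatorname*{argmin}_{u:\,u_{S^c}=0}\Big\{u^\top Cu+\sum_{j\in S}\frac{\operatorname{sgn}(\beta^*_j)}{|\beta^*_j|^{\gamma_1}}u_j\Big\}.$$ -/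

import Mathlib

open MeasureTheory ProbabilityTheory Filter Topology
open scoped ENNReal NNReal Matrix

namespace AdaptiveTransferLasso

/-- Vectors of regression coefficients, with the Euclidean norm. -/
abbrev Coef (p : ℕ) : Type := EuclideanSpace ℝ (Fin p)

/-- The response vector `y = X β + ε` of a linear model. -/
noncomputable def response {n p : ℕ} (X : Matrix (Fin n) (Fin p) ℝ) (β : Coef p)
    (ε : Fin n → ℝ) : Fin n → ℝ :=
  X *ᵥ β.ofLp + ε

/-- The adaptive transfer lasso objective
`(1/n) ‖y - X β‖² + (lam/n) ∑ⱼ vⱼ |βⱼ| + (eta/n) ∑ⱼ wⱼ |βⱼ - βtⱼ|`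
with `vⱼ = 1 / |βtⱼ| ^ γ₁` and `wⱼ = |βtⱼ| ^ γ₂`.  It takes values in `[0, ∞]`: if `βtⱼ = 0` and
`γ₁ > 0`, then `vⱼ = ∞`, so that (for `lam > 0`) the `j`-th coefficient is forced to vanish; here
`∞ * 0 = 0`, and `0 ^ 0 = 1`. -/
noncomputable def objective {n p : ℕ} (X : Matrix (Fin n) (Fin p) ℝ) (y : Fin n → ℝ)
    (βt : Coef p) (lam eta γ₁ γ₂ : ℝ) (β : Coef p) : ℝ≥0∞ :=
  ENNReal.ofReal (1 / n * ‖WithLp.toLp 2 (y - X *ᵥ β.ofLp)‖ ^ 2)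
    + ENNReal.ofReal (lam / n) *
        ∑ j, (ENNReal.ofReal (|βt j| ^ γ₁))⁻¹ * ENNReal.ofReal |β j|
    + ENNReal.ofReal (eta / n) *
        ∑ j, ENNReal.ofReal (|βt j| ^ γ₂) * ENNReal.ofReal |β j - βt j|

/-- `β` minimizes the adaptive transfer lasso objective over all coefficient vectors. -/
def IsEstimate {n p : ℕ} (X : Matrix (Fin n) (Fin p) ℝ) (y : Fin n → ℝ)
    (βt : Coef p) (lam eta γ₁ γ₂ : ℝ) (β : Coef p) : Prop :=
  ∀ b : Coef p, objective X y βt lam eta γ₁ γ₂ β ≤ objective X y βt lam eta γ₁ γ₂ b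

/-- The active set `S` of a coefficient vector. -/
noncomputable def active {p : ℕ} (β : Coef p) : Finset (Fin p) :=
  {j | β j ≠ 0}

/-- The quadratic form `uᵀ C u`. -/
noncomputable def quad {p : ℕ} (C : Matrix (Fin p) (Fin p) ℝ) (u : Coef p) : ℝ :=
  u.ofLp ⬝ᵥ (C *ᵥ u.ofLp)

/-- `u` is the unique minimizer of `f` over `U`, that is, `u = argmin_{v ∈ U} f v`. -/
def IsArgmin {p : ℕ} (U : Set (Coef p)) (f : Coef p → ℝ) (u : Coef p) : Prop :=
  u ∈ U ∧ ∀ v ∈ U, v ≠ u → f u < f v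

end AdaptiveTransferLasso

open AdaptiveTransferLasso

/-!
Weak convergence of the estimator follows from a statement about realizations.  The scaled initial
error and the score `Xᵀ ε / √n` converge jointly in distribution, and by an extended continuous
mapping theorem it suffices to show that the local parameter `s (β̂ - β*)` converges along every
sequence of realizations along which these two converge.

There, `s (β̂ - β*)` minimizes a quadratic objective, converging to `uᵀ C u - 2 uᵀ w`, plus a
separable penalty.  In each regime the penalty of a coordinate either converges, and the coordinate
stays free, or one of its two parts grows at infinite rate away from its kink and dominates the
other one, which pins the coordinate there: at the value `0` for the lasso part, at the initial
estimate for the transfer part.  Strict convexity of the limit then identifies the limit of the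
minimizers.  An infinite lasso weight may be replaced by a real lower bound as long as the
competitor vanishes at that coordinate.
-/

namespace AdaptiveTransferLasso

section ConvergenceInDistribution

variable {Ω Ω' : Type*} [MeasurableSpace Ω] [MeasurableSpace Ω']
  {P : Measure Ω} [IsProbabilityMeasure P] {P' : Measure Ω'} [IsProbabilityMeasure P']
  {E F : Type*}

theorem limsup_map_le_map_closure [PseudoMetricSpace E] [MeasurableSpace E] [BorelSpace E]
    [MeasurableSpace F] {X : ℕ → Ω → E} {Y : ℕ → Ω → F} {Z : Ω' → E} {A : Set E} {K : Set F}
    (hX : TendstoInDistribution X atTop Z (fun _ => P) P') (hY : ∀ n, AEMeasurable (Y n) P)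
    (hK : MeasurableSet K) (hKA : ∀ᶠ n in atTop, ∀ᵐ ω ∂P, Y n ω ∈ K → X n ω ∈ A) :
    limsup (fun n => P.map (Y n) K) atTop ≤ P'.map Z (closure A) := by
  refine le_trans (limsup_le_limsup ?_)
    (ProbabilityMeasure.limsup_measure_closed_le_of_tendsto hX.tendsto isClosed_closure)
  filter_upwards [hKA] with n hn
  simp only [ProbabilityMeasure.coe_mk]
  rw [Measure.map_apply_of_aemeasurable (hY n) hK,
    Measure.map_apply_of_aemeasurable (hX.forall_aemeasurable n) isClosed_closure.measurableSet]
  exact measure_mono_ae (hn.mono fun ω hω hωK => subset_closure (hω hωK))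

theorem exists_seq_tendsto_of_forall_mem_closure [PseudoMetricSpace E] {R : ℕ → E → F → Prop}
    {K : Set F} {x₀ : E} (h : ∀ N, x₀ ∈ closure {x | ∃ k ≥ N, ∃ y ∈ K, R k x y}) :
    ∃ (k : ℕ → ℕ) (x : ℕ → E) (y : ℕ → F), Tendsto k atTop atTop ∧ Tendsto x atTop (𝓝 x₀) ∧
      ∀ i, y i ∈ K ∧ R (k i) (x i) (y i) := by
  have hnear (i : ℕ) :
      ∃ x : E, dist x x₀ < 1 / ((i : ℝ) + 1) ∧ ∃ k ≥ i, ∃ y ∈ K, R k x y := by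
    obtain ⟨x, hx, hxd⟩ :=
      Metric.mem_closure_iff.1 (h i) _ (Nat.one_div_pos_of_nat (α := ℝ) (n := i))
    exact ⟨x, dist_comm x x₀ ▸ hxd, hx⟩
  choose x hx k hk y hy hR using hnear
  exact ⟨k, x, y, tendsto_atTop_mono hk tendsto_id,
    tendsto_iff_dist_tendsto_zero.2 (squeeze_zero (fun _ => dist_nonneg) (fun i => (hx i).le)
      tendsto_one_div_add_atTop_nhds_zero_nat), fun i => ⟨hy i, hR i⟩⟩

-- The extended continuous mapping theorem, with the maps replaced by the relations `R n` so that no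
-- measurable selection is needed.
theorem tendstoInDistribution_of_forall_seq
    [PseudoMetricSpace E] [MeasurableSpace E] [BorelSpace E]
    [PseudoMetricSpace F] [MeasurableSpace F] [BorelSpace F]
    {X : ℕ → Ω → E} {Y : ℕ → Ω → F} {Z : Ω' → E} {G : Ω' → F} (R : ℕ → E → F → Prop)
    (hX : TendstoInDistribution X atTop Z (fun _ => P) P')
    (hY : ∀ n, AEMeasurable (Y n) P) (hG : AEMeasurable G P')
    (hR : ∀ n, ∀ᵐ ω ∂P, R n (X n ω) (Y n ω))
    (h : ∀ᵐ ω ∂P', ∀ (k : ℕ → ℕ) (x : ℕ → E) (y : ℕ → F), Tendsto k atTop atTop →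
      Tendsto x atTop (𝓝 (Z ω)) → (∀ i, R (k i) (x i) (y i)) → Tendsto y atTop (𝓝 (G ω))) :
    TendstoInDistribution Y atTop G (fun _ => P) P' := by
  refine ⟨hY, hG, tendsto_of_forall_isClosed_limsup_le' fun K hK => ?_⟩
  let D (N : ℕ) : Set E := {x | ∃ k ≥ N, ∃ y ∈ K, R k x y}
  have hanti : Antitone fun N => closure (D N) := fun a b hab =>
    closure_mono fun x ⟨k, hk, hy⟩ => ⟨k, hab.trans hk, hy⟩
  have hmeas (N : ℕ) : MeasurableSet (closure (D N)) := isClosed_closure.measurableSet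
  have hlimsup (N : ℕ) : limsup (fun n => P.map (Y n) K) atTop ≤ P'.map Z (closure (D N)) := by
    refine limsup_map_le_map_closure hX hY hK.measurableSet ?_
    filter_upwards [eventually_ge_atTop N] with n hn
    exact (hR n).mono fun ω hω hωK => ⟨n, hn, Y n ω, hωK, hω⟩
  have hlim : Tendsto (fun N => P'.map Z (closure (D N))) atTop
      (𝓝 (P'.map Z (⋂ N, closure (D N)))) :=
    have := Measure.isProbabilityMeasure_map (μ := P') hX.aemeasurable_limit
    tendsto_measure_iInter_atTop (fun N => (hmeas N).nullMeasurableSet) hanti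
      ⟨0, measure_ne_top _ _⟩
  refine (ge_of_tendsto' hlim hlimsup).trans ?_
  simp only [ProbabilityMeasure.coe_mk]
  rw [Measure.map_apply_of_aemeasurable hG hK.measurableSet,
    Measure.map_apply_of_aemeasurable hX.aemeasurable_limit (MeasurableSet.iInter hmeas)]
  refine measure_mono_ae (h.mono fun ω hω hmem => ?_)
  obtain ⟨k, x, y, hk, hx, hy⟩ := exists_seq_tendsto_of_forall_mem_closure (Set.mem_iInter.1 hmem)
  exact hK.mem_of_tendsto (hω k x y hk hx fun i => (hy i).2)
    (Eventually.of_forall fun i => (hy i).1)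

theorem tendstoInDistribution_prodMk_of_indepFun
    [PseudoMetricSpace E] [SecondCountableTopology E] [MeasurableSpace E] [BorelSpace E]
    [PseudoMetricSpace F] [SecondCountableTopology F] [MeasurableSpace F] [BorelSpace F]
    {X : ℕ → Ω → E} {Y : ℕ → Ω → F} {Z : Ω' → E} {W : Ω' → F}
    (hX : TendstoInDistribution X atTop Z (fun _ => P) P')
    (hY : TendstoInDistribution Y atTop W (fun _ => P) P')
    (hXY : ∀ n, IndepFun (X n) (Y n) P) (hZW : IndepFun Z W P') :
    TendstoInDistribution (fun n ω => (X n ω, Y n ω)) atTop (fun ω => (Z ω, W ω))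
      (fun _ => P) P' := by
  have hXm := hX.forall_aemeasurable
  have hYm := hY.forall_aemeasurable
  refine ⟨fun n => (hXm n).prodMk (hYm n), hX.aemeasurable_limit.prodMk hY.aemeasurable_limit, ?_⟩
  have hlim := (ProbabilityMeasure.continuous_prod (α := E) (β := F)).continuousAt.tendsto.comp
    (hX.tendsto.prodMk_nhds hY.tendsto)
  convert! hlim using 2
  · exact congrArg _ (funext fun n => Subtype.ext
      ((indepFun_iff_map_prod_eq_prod_map_map (hXm n) (hYm n)).1 (hXY n)))
  · exact congrArg _ (Subtype.ext ((indepFun_iff_map_prod_eq_prod_map_map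
      hX.aemeasurable_limit hY.aemeasurable_limit).1 hZW))

end ConvergenceInDistribution

section Quadratic

variable {p : ℕ} {C : Matrix (Fin p) (Fin p) ℝ}

theorem dotProduct_eq_inner (u w : Coef p) : u.ofLp ⬝ᵥ w.ofLp = inner ℝ u w := by
  rw [EuclideanSpace.inner_eq_star_dotProduct, star_trivial, dotProduct_comm]

theorem abs_dotProduct_le (u w : Coef p) : |u.ofLp ⬝ᵥ w.ofLp| ≤ ‖u‖ * ‖w‖ := by
  rw [dotProduct_eq_inner]
  exact abs_real_inner_le_norm u w

theorem quad_eq_inner (C : Matrix (Fin p) (Fin p) ℝ) (u : Coef p) :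
    quad C u = inner ℝ u (Matrix.toEuclideanCLM (𝕜 := ℝ) C u) :=
  (Matrix.inner_toEuclideanCLM C u u).symm

theorem continuous_toEuclideanCLM :
    Continuous (Matrix.toEuclideanCLM (n := Fin p) (𝕜 := ℝ)) :=
  LinearMap.continuous_of_finiteDimensional
    (Matrix.toEuclideanCLM (n := Fin p) (𝕜 := ℝ)).toAlgEquiv.toLinearMap

theorem continuous_quad : Continuous fun q : Matrix (Fin p) (Fin p) ℝ × Coef p => quad q.1 q.2 := by
  simp only [quad_eq_inner]
  have := continuous_toEuclideanCLM (p := p)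
  fun_prop

theorem quad_smul (C : Matrix (Fin p) (Fin p) ℝ) (a : ℝ) (u : Coef p) :
    quad C (a • u) = a ^ 2 * quad C u := by
  simp only [quad_eq_inner, map_smul, real_inner_smul_left, real_inner_smul_right]
  ring

theorem abs_quad_le (C : Matrix (Fin p) (Fin p) ℝ) (u : Coef p) :
    |quad C u| ≤ ‖Matrix.toEuclideanCLM (𝕜 := ℝ) C‖ * ‖u‖ ^ 2 := by
  rw [quad_eq_inner]
  calc |inner ℝ u (Matrix.toEuclideanCLM (𝕜 := ℝ) C u)|
      ≤ ‖u‖ * ‖Matrix.toEuclideanCLM (𝕜 := ℝ) C u‖ := abs_real_inner_le_norm _ _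
    _ ≤ ‖u‖ * (‖Matrix.toEuclideanCLM (𝕜 := ℝ) C‖ * ‖u‖) := by
        gcongr; exact ContinuousLinearMap.le_opNorm _ _
    _ = ‖Matrix.toEuclideanCLM (𝕜 := ℝ) C‖ * ‖u‖ ^ 2 := by ring

theorem quad_pos (hC : C.PosDef) {u : Coef p} (hu : u ≠ 0) : 0 < quad C u := by
  simpa [quad] using hC.dotProduct_mulVec_pos (x := u.ofLp) (by simpa using hu)

theorem strictConvexOn_quad (hC : C.PosDef) : StrictConvexOn ℝ Set.univ (quad C) := by
  refine ⟨convex_univ, fun u _ v _ huv a b ha hb hab => ?_⟩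
  have hgap : a * quad C u + b * quad C v - quad C (a • u + b • v) = a * b * quad C (u - v) := by
    obtain rfl : b = 1 - a := by linarith
    simp only [quad_eq_inner, map_add, map_sub, map_smul, inner_add_left, inner_add_right,
      inner_sub_left, inner_sub_right, real_inner_smul_left, real_inner_smul_right]
    ring
  have := mul_pos (mul_pos ha hb) (quad_pos hC (sub_ne_zero.2 huv))
  simp only [smul_eq_mul]
  linarith

theorem exists_mul_sq_norm_le_quad (hC : C.PosDef) :
    ∃ κ > 0, ∀ u : Coef p, κ * ‖u‖ ^ 2 ≤ quad C u := by
  have hcont : Continuous (quad C) := continuous_quad.comp (Continuous.prodMk_right C)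
  obtain ⟨κ, hκ, hle⟩ := (isCompact_sphere (0 : Coef p) 1).exists_forall_le' hcont.continuousOn
    (a := 0) fun u hu => quad_pos hC (ne_zero_of_mem_unit_sphere ⟨u, hu⟩)
  refine ⟨κ, hκ, fun u => ?_⟩
  rcases eq_or_ne u 0 with rfl | hu
  · simp [quad]
  have hn : ‖u‖ ≠ 0 := norm_ne_zero_iff.2 hu
  have h := hle (‖u‖⁻¹ • u) (by simp [norm_smul, hn])
  rw [quad_smul] at h
  calc κ * ‖u‖ ^ 2 ≤ (‖u‖⁻¹ ^ 2 * quad C u) * ‖u‖ ^ 2 := by gcongr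
    _ = quad C u := by field_simp

theorem exists_eventually_mul_sq_norm_le_quad (hC : C.PosDef) {ι : Type*} {l : Filter ι}
    {Cs : ι → Matrix (Fin p) (Fin p) ℝ} (hCs : Tendsto Cs l (𝓝 C)) :
    ∃ κ > 0, ∀ᶠ i in l, ∀ u : Coef p, κ * ‖u‖ ^ 2 ≤ quad (Cs i) u := by
  obtain ⟨κ, hκ, h⟩ := exists_mul_sq_norm_le_quad hC
  have hlim : Tendsto (fun i => ‖Matrix.toEuclideanCLM (𝕜 := ℝ) (Cs i - C)‖) l (𝓝 0) := by
    simpa [Function.comp_def] using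
      ((continuous_toEuclideanCLM.norm.comp (continuous_sub_right C)).tendsto C).comp hCs
  refine ⟨κ / 2, half_pos hκ, ?_⟩
  filter_upwards [hlim.eventually_le_const (half_pos hκ)] with i hi u
  have hsub : quad (Cs i - C) u = quad (Cs i) u - quad C u := by
    simp only [quad, Matrix.sub_mulVec, dotProduct_sub]
  have hdiff : |quad (Cs i) u - quad C u| ≤ κ / 2 * ‖u‖ ^ 2 :=
    hsub ▸ (abs_quad_le _ u).trans (by gcongr)
  linarith [h u, (abs_le.1 hdiff).1]

end Quadratic

section Score

variable {n p : ℕ}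

/-- The normalized Gram matrix of a design. -/
noncomputable def gram (X : Matrix (Fin n) (Fin p) ℝ) : Matrix (Fin p) (Fin p) ℝ :=
  (1 / n : ℝ) • (Xᵀ * X)

/-- The score vector `Xᵀ e / √n`, through which the noise enters the rescaled objective. -/
noncomputable def score (X : Matrix (Fin n) (Fin p) ℝ) (e : Fin n → ℝ) : Coef p :=
  (1 / √(n : ℝ)) • WithLp.toLp 2 (Xᵀ *ᵥ e)

theorem measurable_score (X : Matrix (Fin n) (Fin p) ℝ) : Measurable (score X) := by
  have : Continuous (score X) := by
    unfold score
    fun_prop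
  exact this.measurable

theorem inner_score (X : Matrix (Fin n) (Fin p) ℝ) (e : Fin n → ℝ) (t : Coef p) :
    inner ℝ (score X e) t =
      inner ℝ (WithLp.toLp 2 e) (WithLp.toLp 2 ((1 / √(n : ℝ)) • (X *ᵥ t.ofLp))) := by
  simp only [score, EuclideanSpace.inner_eq_star_dotProduct, WithLp.ofLp_smul, star_trivial]
  rw [dotProduct_smul, smul_dotProduct, Matrix.mulVec_transpose, dotProduct_comm t.ofLp,
    ← Matrix.dotProduct_mulVec, dotProduct_comm e]

theorem quad_gram (X : Matrix (Fin n) (Fin p) ℝ) (t : Coef p) :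
    quad (gram X) t = 1 / n * ‖WithLp.toLp 2 (X *ᵥ t.ofLp)‖ ^ 2 := by
  rw [quad, gram, Matrix.smul_mulVec, dotProduct_smul, ← Matrix.mulVec_mulVec,
    Matrix.dotProduct_mulVec, Matrix.vecMul_transpose, smul_eq_mul, ← real_inner_self_eq_norm_sq,
    EuclideanSpace.inner_eq_star_dotProduct, star_trivial]

variable {Ω Ω' : Type*} [MeasurableSpace Ω] [MeasurableSpace Ω'] {P : Measure Ω} {P' : Measure Ω'}
  {σ : ℝ≥0}

theorem charFun_map_of_iIndepFun_gaussianReal {ε : Fin n → Ω → ℝ}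
    (hε : ∀ i, HasLaw (ε i) (gaussianReal 0 (σ ^ 2)) P) (hind : iIndepFun ε P)
    (t : EuclideanSpace ℝ (Fin n)) :
    charFun (P.map fun ω => WithLp.toLp 2 fun i => ε i ω) t =
      Complex.exp (-((σ ^ 2 * ‖t‖ ^ 2 : ℝ) : ℂ) / 2) := by
  have := hind.isProbabilityMeasure
  rw [(iIndepFun_iff_charFun_pi fun i => (hε i).aemeasurable).1 hind]
  simp_rw [(hε _).map_eq, charFun_gaussianReal, ← Complex.exp_sum, EuclideanSpace.real_norm_sq_eq]
  congr 1
  push_cast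
  rw [Finset.mul_sum, ← Finset.sum_neg_distrib, Finset.sum_div]
  exact Finset.sum_congr rfl fun i _ => by ring

theorem charFun_map_score (X : Matrix (Fin n) (Fin p) ℝ) {ε : Fin n → Ω → ℝ}
    (hε : ∀ i, HasLaw (ε i) (gaussianReal 0 (σ ^ 2)) P) (hind : iIndepFun ε P) (t : Coef p) :
    charFun (P.map fun ω => score X fun i => ε i ω) t =
      Complex.exp (-((σ ^ 2 * quad (gram X) t : ℝ) : ℂ) / 2) := by
  have hvec : AEMeasurable (fun ω i => ε i ω) P :=
    aemeasurable_pi_lambda _ fun i => (hε i).aemeasurable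
  have hpull : charFun (P.map fun ω => score X fun i => ε i ω) t =
      charFun (P.map fun ω => WithLp.toLp 2 fun i => ε i ω)
        (WithLp.toLp 2 ((1 / √(n : ℝ)) • (X *ᵥ t.ofLp))) := by
    rw [charFun_apply, charFun_apply, integral_map, integral_map]
    · simp_rw [inner_score]
    · exact (WithLp.measurable_toLp 2 _).comp_aemeasurable hvec
    · exact Measurable.aestronglyMeasurable (by fun_prop)
    · exact (measurable_score X).comp_aemeasurable hvec
    · exact Measurable.aestronglyMeasurable (by fun_prop)
  rw [hpull, charFun_map_of_iIndepFun_gaussianReal hε hind, quad_gram, WithLp.toLp_smul, norm_smul,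
    mul_pow, Real.norm_eq_abs, sq_abs, one_div_pow, Real.sq_sqrt (Nat.cast_nonneg n)]

theorem tendstoInDistribution_score [IsProbabilityMeasure P] [IsProbabilityMeasure P']
    {X : (n : ℕ) → Matrix (Fin n) (Fin p) ℝ} {C : Matrix (Fin p) (Fin p) ℝ} (hC : C.PosSemidef)
    (hXC : Tendsto (fun n => gram (X n)) atTop (𝓝 C))
    {ε : (n : ℕ) → Fin n → Ω → ℝ} (hε : ∀ n i, HasLaw (ε n i) (gaussianReal 0 (σ ^ 2)) P)
    (hεindep : ∀ n, iIndepFun (ε n) P) {W : Ω' → Coef p}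
    (hW : HasLaw W (multivariateGaussian 0 ((σ : ℝ) ^ 2 • C)) P') :
    TendstoInDistribution (fun n ω => score (X n) fun i => ε n i ω) atTop W (fun _ => P) P' := by
  refine ⟨fun n => (measurable_score _).comp_aemeasurable
    (aemeasurable_pi_lambda _ fun i => (hε n i).aemeasurable), hW.aemeasurable,
    ProbabilityMeasure.tendsto_of_tendsto_charFun fun t => ?_⟩
  simp only [ProbabilityMeasure.coe_mk]
  rw [hW.map_eq, charFun_multivariateGaussian (hC.smul (sq_nonneg _))]
  simp_rw [charFun_map_score _ (hε _) (hεindep _)]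
  have hcont : Continuous fun D => Complex.exp (-((σ ^ 2 * quad D t : ℝ) : ℂ) / 2) := by
    have : Continuous fun D => quad D t := continuous_quad.comp (Continuous.prodMk_left t)
    fun_prop
  convert (hcont.tendsto C).comp hXC using 3
  · rfl
  simp only [inner_zero_right, quad, Matrix.smul_mulVec, dotProduct_smul, smul_eq_mul]
  push_cast
  ring

end Score

section Argmin

variable {p : ℕ}

/-- The quadratic objective `vᵀ C v - 2 vᵀ w` with the separable penalty `h` on the coordinates in
`T`.  The rescaled lasso objectives and their limits all have this form; the coordinates outside
`T` are those that the limit problem constrains. -/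
noncomputable def penalizedQuad (C : Matrix (Fin p) (Fin p) ℝ) (w : Coef p) (T : Finset (Fin p))
    (h : Fin p → ℝ → ℝ) (v : Coef p) : ℝ :=
  quad C v - 2 * (v.ofLp ⬝ᵥ w.ofLp) + ∑ j ∈ T, h j (v j)

/-- The affine subspace of the vectors that agree with `c` outside the free coordinates `T`. -/
def pinned (T : Finset (Fin p)) (c : Coef p) : Set (Coef p) :=
  {v | ∀ j ∉ T, v j = c j}

theorem isClosed_pinned (T : Finset (Fin p)) (c : Coef p) : IsClosed (pinned T c) := by
  simp only [pinned, Set.ofPred_forall]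
  exact isClosed_iInter fun j => isClosed_iInter fun _ =>
    isClosed_eq (by fun_prop) continuous_const

theorem convex_pinned (T : Finset (Fin p)) (c : Coef p) : Convex ℝ (pinned T c) := by
  intro u hu v hv a b _ _ hab j hj
  simp [hu j hj, hv j hj, ← add_mul, hab]

theorem abs_apply_le_norm (u : Coef p) (j : Fin p) : |u j| ≤ ‖u‖ := by
  simpa using PiLp.norm_apply_le u j

theorem norm_le_sum_abs (u : Coef p) : ‖u‖ ≤ ∑ j, |u j| := by
  have hu : u = ∑ j, u j • EuclideanSpace.single j (1 : ℝ) := by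
    ext k
    simp [Finset.sum_apply, Pi.single_apply]
  calc ‖u‖ = ‖∑ j, u j • EuclideanSpace.single j (1 : ℝ)‖ := by rw [← hu]
    _ ≤ ∑ j, ‖u j • EuclideanSpace.single j (1 : ℝ)‖ := norm_sum_le _ _
    _ = ∑ j, |u j| := by simp [norm_smul]

theorem abs_apply_le_of_sum_mul_abs_le {r : Coef p} {α : Fin p → ℝ} {K μ : ℝ} (hK : 0 ≤ K)
    (hα : ∀ k, 2 * K < α k) (hsum : ∑ k, α k * |r k| ≤ K * ‖r‖ + μ) (j : Fin p) :
    |r j| ≤ 2 * (μ / α j) := by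
  have hα_pos (k : Fin p) : 0 < α k := lt_of_le_of_lt (by positivity) (hα k)
  have hnorm : K * ‖r‖ ≤ ∑ k, α k / 2 * |r k| :=
    calc K * ‖r‖ ≤ K * ∑ k, |r k| := mul_le_mul_of_nonneg_left (norm_le_sum_abs r) hK
      _ ≤ ∑ k, α k / 2 * |r k| := by
          rw [Finset.mul_sum]
          gcongr with k
          linarith [hα k]
  have hhalf : ∑ k, α k * |r k| = 2 * ∑ k, α k / 2 * |r k| := by
    rw [Finset.mul_sum]
    exact Finset.sum_congr rfl fun k _ => by ring
  have hterm : α j / 2 * |r j| ≤ ∑ k, α k / 2 * |r k| :=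
    Finset.single_le_sum (f := fun k => α k / 2 * |r k|)
      (fun k _ => mul_nonneg (half_pos (hα_pos k)).le (abs_nonneg _)) (Finset.mem_univ j)
  rw [← mul_div_assoc, le_div_iff₀ (hα_pos j)]
  linarith

theorem tendsto_coef_apply {ι : Type*} {l : Filter ι} {u : ι → Coef p} {v : Coef p}
    (hu : Tendsto u l (𝓝 v)) (j : Fin p) : Tendsto (fun i => u i j) l (𝓝 (v j)) :=
  ((EuclideanSpace.proj (𝕜 := ℝ) j).continuous.tendsto v).comp hu

theorem le_penalizedQuad {C : Matrix (Fin p) (Fin p) ℝ} {w : Coef p} {T : Finset (Fin p)}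
    {h : Fin p → ℝ → ℝ} {κ r L : ℝ} (hκ : 0 < κ) (hC : ∀ u, κ * ‖u‖ ^ 2 ≤ quad C u)
    (hw : ‖w‖ ≤ r) (hL : 0 ≤ L) (hh : ∀ j ∈ T, ∀ x, -(L * (1 + |x|)) ≤ h j x) (v : Coef p) :
    κ / 2 * ‖v‖ ^ 2 - (p * L + (2 * r + p * L) ^ 2 / (2 * κ)) ≤ penalizedQuad C w T h v := by
  have hlin : v.ofLp ⬝ᵥ w.ofLp ≤ ‖v‖ * r :=
    (le_abs_self _).trans ((abs_dotProduct_le v w).trans (by gcongr))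
  have hpen : -(p * (L * (1 + ‖v‖))) ≤ ∑ j ∈ T, h j (v j) := by
    have hcard : (T.card : ℝ) ≤ p := by exact_mod_cast T.card_le_univ.trans_eq (Fintype.card_fin p)
    calc -(p * (L * (1 + ‖v‖))) ≤ -(T.card * (L * (1 + ‖v‖))) := by gcongr
      _ = ∑ _j ∈ T, -(L * (1 + ‖v‖)) := by simp
      _ ≤ ∑ j ∈ T, h j (v j) := Finset.sum_le_sum fun j hj =>
          le_trans (by gcongr; exact abs_apply_le_norm v j) (hh j hj _)
  have hyoung : (2 * r + p * L) * ‖v‖ ≤ κ / 2 * ‖v‖ ^ 2 + (2 * r + p * L) ^ 2 / (2 * κ) := by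
    have hsq : κ / 2 * ‖v‖ ^ 2 + (2 * r + p * L) ^ 2 / (2 * κ) - (2 * r + p * L) * ‖v‖ =
        (κ * ‖v‖ - (2 * r + p * L)) ^ 2 / (2 * κ) := by
      field_simp
      ring
    exact sub_nonneg.1 (hsq ▸ by positivity)
  unfold penalizedQuad
  linarith [hC v]

theorem sum_sub_le_of_penalizedQuad_le {D : Matrix (Fin p) (Fin p) ℝ} {w u c : Coef p}
    {T : Finset (Fin p)} {h : Fin p → ℝ → ℝ} (hD : 0 ≤ quad D (u - c))
    (hle : penalizedQuad D w T h u ≤ penalizedQuad D w T h c) :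
    ∑ j ∈ T, (h j (u j) - h j (c j)) ≤
      2 * (‖Matrix.toEuclideanCLM (𝕜 := ℝ) D‖ * ‖c‖ + ‖w‖) * ‖u - c‖ := by
  set L := Matrix.toEuclideanCLM (𝕜 := ℝ) D
  obtain ⟨r, rfl⟩ : ∃ r, u = c + r := ⟨u - c, by abel⟩
  rw [add_sub_cancel_left] at hD ⊢
  have hquad : quad D (c + r) = quad D c + inner ℝ c (L r) + inner ℝ r (L c) + quad D r := by
    simp only [quad_eq_inner, map_add, inner_add_left, inner_add_right, L]
    ring
  have hlin : (c + r).ofLp ⬝ᵥ w.ofLp = c.ofLp ⬝ᵥ w.ofLp + r.ofLp ⬝ᵥ w.ofLp := by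
    simp only [dotProduct_eq_inner, inner_add_left]
  have hcr : |inner ℝ c (L r)| ≤ ‖c‖ * (‖L‖ * ‖r‖) :=
    (abs_real_inner_le_norm _ _).trans (by gcongr; exact L.le_opNorm r)
  have hrc : |inner ℝ r (L c)| ≤ ‖r‖ * (‖L‖ * ‖c‖) :=
    (abs_real_inner_le_norm _ _).trans (by gcongr; exact L.le_opNorm c)
  rw [penalizedQuad, penalizedQuad, hquad, hlin] at hle
  rw [Finset.sum_sub_distrib]
  linarith [(abs_le.1 hcr).1, (abs_le.1 hrc).1, (abs_le.1 (abs_dotProduct_le r w)).2]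

theorem strictConvexOn_penalizedQuad {C : Matrix (Fin p) (Fin p) ℝ} (hC : C.PosDef) (w : Coef p)
    {T : Finset (Fin p)} {h : Fin p → ℝ → ℝ} (hh : ∀ j ∈ T, ConvexOn ℝ Set.univ (h j)) :
    StrictConvexOn ℝ Set.univ (penalizedQuad C w T h) := by
  have hlin : ConvexOn ℝ Set.univ fun v : Coef p => -(2 * (v.ofLp ⬝ᵥ w.ofLp)) := by
    simp only [dotProduct_eq_inner, ← inner_neg_right, ← real_inner_smul_right _ _ (2 : ℝ)]
    exact ((innerₗ (Coef p)).flip _).convexOn convex_univ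
  have hsep : ConvexOn ℝ Set.univ fun v : Coef p => ∑ j ∈ T, h j (v j) := by
    refine ⟨convex_univ, fun u _ v _ a b ha hb hab => ?_⟩
    simp only [smul_eq_mul, Finset.mul_sum, ← Finset.sum_add_distrib]
    exact Finset.sum_le_sum fun j hj => (hh j hj).2 trivial trivial ha hb hab
  exact ((strictConvexOn_quad hC).add_convexOn hlin).add_convexOn hsep

theorem exists_isArgmin_penalizedQuad {C : Matrix (Fin p) (Fin p) ℝ} (hC : C.PosDef) (w : Coef p)
    {T : Finset (Fin p)} (c : Coef p) {h : Fin p → ℝ → ℝ} {L : ℝ} (hL : 0 ≤ L)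
    (hle : ∀ j ∈ T, ∀ x, -(L * (1 + |x|)) ≤ h j x) (hcont : ∀ j ∈ T, Continuous (h j))
    (hconv : ∀ j ∈ T, ConvexOn ℝ Set.univ (h j)) :
    ∃ u, IsArgmin (pinned T c) (penalizedQuad C w T h) u := by
  obtain ⟨κ, hκ, hquad⟩ := exists_mul_sq_norm_le_quad hC
  have hF : Continuous (penalizedQuad C w T h) := by
    have : Continuous (quad C) := continuous_quad.comp (Continuous.prodMk_right C)
    have : Continuous fun v : Coef p => ∑ j ∈ T, h j (v j) :=
      continuous_finsetSum _ fun j hj => (hcont j hj).comp (by fun_prop)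
    unfold penalizedQuad
    fun_prop
  have hcoercive : Tendsto (penalizedQuad C w T h) (cocompact (Coef p)) atTop :=
    tendsto_atTop_mono (le_penalizedQuad hκ hquad le_rfl hL hle)
      (tendsto_atTop_add_const_right _ _
        (((tendsto_pow_atTop two_ne_zero).comp tendsto_norm_cocompact_atTop).const_mul_atTop
          (half_pos hκ)))
  obtain ⟨u, hu, hmin⟩ := hF.continuousOn.exists_isMinOn' (isClosed_pinned T c)
    (fun _ _ => rfl : c ∈ pinned T c)
    ((hcoercive.eventually_ge_atTop _).filter_mono inf_le_left)
  have hstrict := (strictConvexOn_penalizedQuad hC w hconv).subset (Set.subset_univ _)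
    (convex_pinned T c)
  exact ⟨u, hu, fun v hv hvu => (hmin hv).lt_of_ne fun heq =>
    hvu (hstrict.eq_of_isMinOn (fun x hx => heq ▸ hmin hx) hmin hv hu)⟩

/-- Convergence of the penalized quadratic objectives with data `(Cs i, ws i, h i)` to the one with
data `(C, w, h₀)`, in the sense of continuous convergence, and with a linear minorant of the
penalties that makes the objectives uniformly coercive. -/
structure PenalizedQuadTendsto {ι : Type*} (l : Filter ι) (T : Finset (Fin p))
    (Cs : ι → Matrix (Fin p) (Fin p) ℝ) (ws : ι → Coef p) (h : ι → Fin p → ℝ → ℝ)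
    (C : Matrix (Fin p) (Fin p) ℝ) (w : Coef p) (h₀ : Fin p → ℝ → ℝ) : Prop where
  posDef : C.PosDef
  tendsto_matrix : Tendsto Cs l (𝓝 C)
  tendsto_linear : Tendsto ws l (𝓝 w)
  tendsto_penalty : ∀ j ∈ T, ∀ x,
    Tendsto (fun q : ι × ℝ => h q.1 j q.2) (l ×ˢ 𝓝 x) (𝓝 (h₀ j x))
  le_penalty : ∃ L, 0 ≤ L ∧ ∀ᶠ i in l, ∀ j ∈ T, ∀ x, -(L * (1 + |x|)) ≤ h i j x

namespace PenalizedQuadTendsto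

variable {ι : Type*} {l : Filter ι} {T : Finset (Fin p)} {Cs : ι → Matrix (Fin p) (Fin p) ℝ}
  {ws : ι → Coef p} {h : ι → Fin p → ℝ → ℝ} {C : Matrix (Fin p) (Fin p) ℝ} {w : Coef p}
  {h₀ : Fin p → ℝ → ℝ} {cs u : ι → Coef p} {c u₀ : Coef p}

theorem mono {l' : Filter ι} (H : PenalizedQuadTendsto l T Cs ws h C w h₀) (hl : l' ≤ l) :
    PenalizedQuadTendsto l' T Cs ws h C w h₀ where
  posDef := H.posDef
  tendsto_matrix := H.tendsto_matrix.mono_left hl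
  tendsto_linear := H.tendsto_linear.mono_left hl
  tendsto_penalty j hj x := (H.tendsto_penalty j hj x).mono_left (Filter.prod_mono hl le_rfl)
  le_penalty := H.le_penalty.imp fun _ hL => ⟨hL.1, hL.2.filter_mono hl⟩

theorem tendsto_objective (H : PenalizedQuadTendsto l T Cs ws h C w h₀) {v : Coef p}
    (hu : Tendsto u l (𝓝 v)) :
    Tendsto (fun i => penalizedQuad (Cs i) (ws i) T (h i) (u i)) l
      (𝓝 (penalizedQuad C w T h₀ v)) := by
  have hquad : Tendsto (fun i => quad (Cs i) (u i)) l (𝓝 (quad C v)) :=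
    (continuous_quad.tendsto (C, v)).comp (H.tendsto_matrix.prodMk_nhds hu)
  have hlin : Tendsto (fun i => (u i).ofLp ⬝ᵥ (ws i).ofLp) l (𝓝 (v.ofLp ⬝ᵥ w.ofLp)) := by
    simp only [dotProduct_eq_inner]
    exact hu.inner H.tendsto_linear
  exact (hquad.sub (hlin.const_mul 2)).add (tendsto_finsetSum _ fun j hj =>
    (H.tendsto_penalty j hj (v j)).comp (tendsto_id.prodMk (tendsto_coef_apply hu j)))

theorem exists_eventually_le (H : PenalizedQuadTendsto l T Cs ws h C w h₀) :
    ∃ κ > 0, ∃ K, ∀ᶠ i in l, ∀ v, κ * ‖v‖ ^ 2 - K ≤ penalizedQuad (Cs i) (ws i) T (h i) v := by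
  obtain ⟨κ, hκ, hquad⟩ := exists_eventually_mul_sq_norm_le_quad H.posDef H.tendsto_matrix
  obtain ⟨L, hL, hle⟩ := H.le_penalty
  refine ⟨κ / 2, half_pos hκ, p * L + (2 * (‖w‖ + 1) + p * L) ^ 2 / (2 * κ), ?_⟩
  filter_upwards [hquad, hle, H.tendsto_linear.norm.eventually_le_const (lt_add_one ‖w‖)]
    with i hquad hle hw v
  exact le_penalizedQuad hκ hquad hw hL hle v

theorem exists_eventually_norm_le (H : PenalizedQuadTendsto l T Cs ws h C w h₀)
    (hcs : Tendsto cs l (𝓝 c))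
    (hu : ∀ᶠ i in l, penalizedQuad (Cs i) (ws i) T (h i) (u i) ≤
      penalizedQuad (Cs i) (ws i) T (h i) (cs i)) :
    ∃ R, ∀ᶠ i in l, ‖u i‖ ≤ R := by
  obtain ⟨κ, hκ, K, hK⟩ := H.exists_eventually_le
  set M := penalizedQuad C w T h₀ c + 1
  refine ⟨√((M + K) / κ), ?_⟩
  filter_upwards [hK, hu, (H.tendsto_objective hcs).eventually_le_const (lt_add_one _)]
    with i hK hu hM
  exact Real.le_sqrt_of_sq_le ((le_div_iff₀' hκ).2 (by linarith [hK (u i)]))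

theorem tendsto_of_le_of_tendsto_apply (H : PenalizedQuadTendsto l T Cs ws h C w h₀)
    (hu₀ : IsArgmin (pinned T c) (penalizedQuad C w T h₀) u₀) (hcs : Tendsto cs l (𝓝 c))
    (hpin : ∀ j ∉ T, Tendsto (fun i => u i j) l (𝓝 (c j)))
    (hle : ∀ᶠ i in l, ∀ v ∈ pinned T (cs i), penalizedQuad (Cs i) (ws i) T (h i) (u i) ≤
      penalizedQuad (Cs i) (ws i) T (h i) v) :
    Tendsto u l (𝓝 u₀) := by
  classical
  obtain ⟨R, hR⟩ := H.exists_eventually_norm_le hcs (hle.mono fun i hi => hi _ fun _ _ => rfl)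
  refine (isCompact_closedBall (0 : Coef p) R).tendsto_nhds_of_unique_mapClusterPt
    (hR.mono fun i hi => by simpa using hi) fun v _ hv => ?_
  obtain ⟨U, hU, huv⟩ := mapClusterPt_iff_ultrafilter.1 hv
  have hvmem : v ∈ pinned T c := fun j hj =>
    tendsto_nhds_unique (tendsto_coef_apply huv j) ((hpin j hj).mono_left hU)
  let v₀ (i : ι) : Coef p := WithLp.toLp 2 fun j => if j ∈ T then u₀ j else cs i j
  have hv₀ : Tendsto v₀ U (𝓝 u₀) := by
    refine (PiLp.continuous_toLp 2 _).continuousAt.tendsto.comp (y := 𝓝 u₀.ofLp) ?_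
    refine tendsto_pi_nhds.2 fun j => ?_
    by_cases hj : j ∈ T
    · simp [hj]
    · simp only [hj, if_false, hu₀.1 j hj]
      exact tendsto_coef_apply (hcs.mono_left hU) j
  by_contra hne
  refine (hu₀.2 v hvmem hne).not_ge
    (le_of_tendsto_of_tendsto ((H.mono hU).tendsto_objective huv)
      ((H.mono hU).tendsto_objective hv₀) ?_)
  exact (hle.filter_mono hU).mono fun i hi => hi _ fun j hj => if_neg hj

theorem tendsto_of_slope_tendsto_atTop (H : PenalizedQuadTendsto l T Cs ws h C w h₀)
    (hu₀ : IsArgmin (pinned T c) (penalizedQuad C w T h₀) u₀) (hcs : Tendsto cs l (𝓝 c))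
    {a : ι → Fin p → ℝ} (ha : ∀ j ∉ T, Tendsto (fun i => a i j) l atTop)
    (hle : ∀ᶠ i in l, ∀ v ∈ pinned T (cs i),
      penalizedQuad (Cs i) (ws i) T (h i) (u i) + ∑ j ∈ Tᶜ, a i j * |u i j - cs i j| ≤
        penalizedQuad (Cs i) (ws i) T (h i) v) :
    Tendsto u l (𝓝 u₀) := by
  have hnonneg : ∀ᶠ i in l, ∀ j ∈ Tᶜ, 0 ≤ a i j * |u i j - cs i j| :=
    (Finset.eventually_all _).2 fun j hj =>
      ((ha j (Finset.mem_compl.1 hj)).eventually_ge_atTop 0).mono fun i hi =>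
        mul_nonneg hi (abs_nonneg _)
  obtain ⟨κ, hκ, K, hK⟩ := H.exists_eventually_le
  set M := penalizedQuad C w T h₀ c + 1
  refine H.tendsto_of_le_of_tendsto_apply hu₀ hcs (fun j hj => ?_) ?_
  · have hgap : Tendsto (fun i => u i j - cs i j) l (𝓝 0) := by
      refine squeeze_zero_norm' ?_ ((ha j hj).const_div_atTop (M + K))
      filter_upwards [hK, hle, hnonneg, (ha j hj).eventually_gt_atTop 0,
        (H.tendsto_objective hcs).eventually_le_const (lt_add_one _)] with i hK hle hnonneg ha hM
      have hterm := Finset.single_le_sum hnonneg (Finset.mem_compl.2 hj)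
      have hcs_le := hle (cs i) fun _ _ => rfl
      rw [Real.norm_eq_abs, le_div_iff₀' ha]
      linarith [hK (u i), mul_nonneg hκ.le (sq_nonneg ‖u i‖)]
    simpa using hgap.add (tendsto_coef_apply hcs j)
  · filter_upwards [hle, hnonneg] with i hle hnonneg v hv
    linarith [hle v hv, Finset.sum_nonneg hnonneg]

end PenalizedQuadTendsto

end Argmin

section Penalty

/-- The one-sided directional derivative of `|·|` at `b` in the direction `x`. -/
noncomputable def absDeriv (b x : ℝ) : ℝ :=
  if b = 0 then |x| else SignType.sign b * x

theorem absDeriv_zero (x : ℝ) : absDeriv 0 x = |x| :=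
  if_pos rfl

theorem absDeriv_of_ne_zero {b : ℝ} (hb : b ≠ 0) (x : ℝ) : absDeriv b x = SignType.sign b * x :=
  if_neg hb

theorem abs_absDeriv (b x : ℝ) : |absDeriv b x| = |x| := by
  rcases eq_or_ne b 0 with rfl | hb
  · rw [absDeriv_zero, abs_abs]
  · rw [absDeriv_of_ne_zero hb]
    rcases hb.lt_or_gt with hb | hb <;> simp [hb]

theorem convexOn_absDeriv (b : ℝ) : ConvexOn ℝ Set.univ (absDeriv b) := by
  rcases eq_or_ne b 0 with rfl | hb
  · exact (funext absDeriv_zero : absDeriv 0 = norm) ▸ convexOn_univ_norm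
  · rw [funext (absDeriv_of_ne_zero hb)]
    exact (LinearMap.mulLeft ℝ (SignType.sign b : ℝ)).convexOn convex_univ

theorem continuous_absDeriv (b : ℝ) : Continuous (absDeriv b) := by
  unfold absDeriv
  split_ifs <;> fun_prop

theorem abs_add_sub_abs_eq_absDeriv {b s x : ℝ} (hs : 0 < s) (hx : b ≠ 0 → |x| ≤ s * |b|) :
    |s * b + x| - |s * b| = absDeriv b x := by
  rcases eq_or_ne b 0 with rfl | hb
  · simp [absDeriv_zero]
  obtain ⟨hx₁, hx₂⟩ := abs_le.1 (hx hb)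
  rw [absDeriv_of_ne_zero hb]
  rcases hb.lt_or_gt with hb | hb
  · rw [abs_of_neg hb] at hx₂
    rw [abs_of_nonpos (by linarith), abs_of_neg (mul_neg_of_pos_of_neg hs hb)]
    simp [hb]
  · rw [abs_of_pos hb] at hx₁
    rw [abs_of_nonneg (by linarith), abs_of_pos (mul_pos hs hb)]
    simp [hb]

/-- The penalty of one coordinate in the limit problem, as a function of the local parameter `x`:
the lasso penalty of weight `A` survives through its derivative at the true coefficient `b`, the
transfer penalty of weight `B` through the limit `d` of the rescaled initial estimator. -/
noncomputable def limitPenalty (b A B d x : ℝ) : ℝ :=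
  A * absDeriv b x + B * |x - d|

/-- The penalty of one coordinate in the rescaled lasso problem, as a function of the local
parameter `x` around the rescaled true coefficient `b`, centred to vanish at `x = 0` in its lasso
part. -/
noncomputable def shiftedPenalty (b A B d x : ℝ) : ℝ :=
  A * (|b + x| - |b|) + B * |x - d|

theorem convexOn_limitPenalty (b d : ℝ) {A B : ℝ} (hA : 0 ≤ A) (hB : 0 ≤ B) :
    ConvexOn ℝ Set.univ (limitPenalty b A B d) :=
  ((convexOn_absDeriv b).smul hA).add
    ((by simpa only [Real.dist_eq] using convexOn_univ_dist d :
      ConvexOn ℝ Set.univ fun x => |x - d|).smul hB)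

theorem continuous_limitPenalty (b A B d : ℝ) : Continuous (limitPenalty b A B d) := by
  have := continuous_absDeriv b
  unfold limitPenalty
  fun_prop

theorem neg_mul_le_limitPenalty {A B L : ℝ} (b d x : ℝ) (hA : 0 ≤ A) (hAL : A ≤ L) (hB : 0 ≤ B) :
    -(L * (1 + |x|)) ≤ limitPenalty b A B d x := by
  have habs : -(A * |x|) ≤ A * absDeriv b x :=
    neg_mul_eq_mul_neg A _ ▸
      mul_le_mul_of_nonneg_left (abs_absDeriv b x ▸ neg_abs_le _) hA
  have hLx : A * |x| ≤ L * |x| := by gcongr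
  unfold limitPenalty
  linarith [mul_nonneg hB (abs_nonneg (x - d))]

theorem neg_mul_le_shiftedPenalty {A B L : ℝ} (b d x : ℝ) (hA : 0 ≤ A) (hAL : A ≤ L)
    (hB : 0 ≤ B) : -(L * (1 + |x|)) ≤ shiftedPenalty b A B d x := by
  have habs : A * (|b| - |b + x|) ≤ A * |x| := by
    gcongr
    simpa using abs_sub_abs_le_abs_sub b (b + x)
  have hLx : A * |x| ≤ L * |x| := by gcongr
  unfold shiftedPenalty
  linarith [mul_nonneg hB (abs_nonneg (x - d))]

theorem sub_mul_abs_le_shiftedPenalty_zero {B : ℝ} (A d x : ℝ) (hB : 0 ≤ B) :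
    (A - B) * |x| ≤ shiftedPenalty 0 A B d x - shiftedPenalty 0 A B d 0 := by
  have habs : B * (|d| - |x - d|) ≤ B * |x| := by
    gcongr
    simpa [abs_sub_comm] using abs_sub_abs_le_abs_sub d (d - x)
  simp only [shiftedPenalty, zero_add, abs_zero, zero_sub, abs_neg]
  linarith

theorem sub_mul_abs_sub_le_shiftedPenalty {A : ℝ} (b B d x : ℝ) (hA : 0 ≤ A) :
    (B - A) * |x - d| ≤ shiftedPenalty b A B d x - shiftedPenalty b A B d d := by
  have habs : A * (|b + d| - |b + x|) ≤ A * |x - d| := by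
    gcongr
    simpa [abs_sub_comm] using abs_sub_abs_le_abs_sub (b + d) (b + x)
  simp only [shiftedPenalty, sub_self, abs_zero]
  linarith

theorem mul_sub_le_shiftedPenalty_zero {A B : ℝ} (d x : ℝ) (hA : 0 ≤ A) (hB : 0 ≤ B) :
    B * (|x| - 2 * |d|) ≤ shiftedPenalty 0 A B d x - shiftedPenalty 0 A B d 0 := by
  have hx : |x| - |d| ≤ |x - d| := abs_sub_abs_le_abs_sub x d
  simp only [shiftedPenalty, zero_add, abs_zero, sub_zero, zero_sub, abs_neg]
  nlinarith [mul_nonneg hA (abs_nonneg x), mul_le_mul_of_nonneg_left hx hB]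

theorem tendsto_limitPenalty {ι : Type*} {l : Filter ι} (b : ℝ) {A B d : ι → ℝ} {A₀ B₀ d₀ : ℝ}
    (hA : Tendsto A l (𝓝 A₀)) (hB : Tendsto B l (𝓝 B₀)) (hd : Tendsto d l (𝓝 d₀)) (x : ℝ) :
    Tendsto (fun q : ι × ℝ => limitPenalty b (A q.1) (B q.1) (d q.1) q.2) (l ×ˢ 𝓝 x)
      (𝓝 (limitPenalty b A₀ B₀ d₀ x)) :=
  ((hA.comp tendsto_fst).mul (((continuous_absDeriv b).tendsto x).comp tendsto_snd)).add
    ((hB.comp tendsto_fst).mul (tendsto_snd.sub (hd.comp tendsto_fst)).abs)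

theorem tendsto_shiftedPenalty {ι : Type*} {l : Filter ι} (b : ℝ) {s A B d : ι → ℝ}
    {A₀ B₀ d₀ : ℝ} (hs : Tendsto s l atTop) (hA : Tendsto A l (𝓝 A₀)) (hB : Tendsto B l (𝓝 B₀))
    (hd : Tendsto d l (𝓝 d₀)) (x : ℝ) :
    Tendsto (fun q : ι × ℝ => shiftedPenalty (s q.1 * b) (A q.1) (B q.1) (d q.1) q.2) (l ×ˢ 𝓝 x)
      (𝓝 (limitPenalty b A₀ B₀ d₀ x)) := by
  refine (tendsto_limitPenalty b hA hB hd x).congr' ?_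
  have hnear : ∀ᶠ i in l, b ≠ 0 → |x| + 1 ≤ s i * |b| := by
    by_cases hb : b = 0
    · exact Eventually.of_forall fun _ h => absurd hb h
    · exact ((hs.atTop_mul_const (abs_pos.2 hb)).eventually_ge_atTop _).mono fun _ h _ => h
  have hx : ∀ᶠ x' in 𝓝 x, |x'| ≤ |x| + 1 := continuous_abs.continuousAt.eventually_le_const
    (lt_add_one _)
  filter_upwards [((hs.eventually_gt_atTop 0).and hnear).prod_mk hx] with q ⟨⟨hs, hnear⟩, hx⟩
  simp only [shiftedPenalty, limitPenalty]
  rw [abs_add_sub_abs_eq_absDeriv hs fun hb => hx.trans (hnear hb)]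

end Penalty

section ArgminSelection

variable {p : ℕ} {C : Matrix (Fin p) (Fin p) ℝ}

theorem exists_continuous_isArgmin (hC : C.PosDef) (T : Finset (Fin p)) (b : Fin p → ℝ)
    {Q : Type*} [TopologicalSpace Q] {A B d : Q → Fin p → ℝ} {w c : Q → Coef p}
    (hA : Continuous A) (hB : Continuous B) (hd : Continuous d) (hw : Continuous w)
    (hc : Continuous c) (hA0 : ∀ q, 0 ≤ A q) (hB0 : ∀ q, 0 ≤ B q) :
    ∃ G : Q → Coef p, Continuous G ∧ ∀ q, IsArgmin (pinned T (c q))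
      (penalizedQuad C (w q) T fun j => limitPenalty (b j) (A q j) (B q j) (d q j)) (G q) := by
  have hsum (q : Q) (j : Fin p) : A q j ≤ ∑ k, A q k :=
    Finset.single_le_sum (fun k _ => hA0 q k) (Finset.mem_univ j)
  choose G hG using fun q => exists_isArgmin_penalizedQuad hC (w q) (T := T) (c q)
    (h := fun j => limitPenalty (b j) (A q j) (B q j) (d q j))
    (Finset.sum_nonneg fun k _ => hA0 q k)
    (fun j _ x => neg_mul_le_limitPenalty _ _ x (hA0 q j) (hsum q j) (hB0 q j))
    (fun j _ => continuous_limitPenalty _ _ _ _)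
    fun j _ => convexOn_limitPenalty _ _ (hA0 q j) (hB0 q j)
  have hA' := continuous_pi_iff.1 hA
  have hlim (q : Q) : PenalizedQuadTendsto (𝓝 q) T (fun _ => C) w
      (fun q' j => limitPenalty (b j) (A q' j) (B q' j) (d q' j)) C (w q)
      fun j => limitPenalty (b j) (A q j) (B q j) (d q j) :=
    { posDef := hC
      tendsto_matrix := tendsto_const_nhds
      tendsto_linear := hw.tendsto q
      tendsto_penalty := fun j _ x => tendsto_limitPenalty (b j) ((hA' j).tendsto q)
        ((continuous_pi_iff.1 hB j).tendsto q) ((continuous_pi_iff.1 hd j).tendsto q) x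
      le_penalty := by
        have hsumcont : Continuous fun q => ∑ k, A q k :=
          continuous_finsetSum _ fun k _ => hA' k
        refine ⟨∑ k, A q k + 1, add_nonneg (Finset.sum_nonneg fun k _ => hA0 q k) zero_le_one, ?_⟩
        filter_upwards [(hsumcont.tendsto q).eventually_le_const (lt_add_one _)] with q' hq' j _ x
        exact neg_mul_le_limitPenalty _ _ x (hA0 q' j) ((hsum q' j).trans hq') (hB0 q' j) }
  refine ⟨G, continuous_iff_continuousAt.2 fun q => ?_, hG⟩
  refine (hlim q).tendsto_of_le_of_tendsto_apply (hG q) (hc.tendsto q) (fun j hj => ?_)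
    (Eventually.of_forall fun q' v hv => ?_)
  · simp only [fun q' => (hG q').1 j hj]
    exact tendsto_coef_apply (hc.tendsto q) j
  · rcases eq_or_ne v (G q') with rfl | hne
    · exact le_rfl
    · exact ((hG q').2 v hv hne).le

end ArgminSelection

section Reduction

variable {n p : ℕ} {X : Matrix (Fin n) (Fin p) ℝ} {y : Fin n → ℝ} {βt : Coef p}
  {lam eta γ₁ γ₂ : ℝ} {a : Fin p → ℝ} {E : Finset (Fin p)}

/-- The objective with real numbers `a j` in place of the weights `lam / |βt j| ^ γ₁`, which may be
infinite. -/
noncomputable def realObjective (X : Matrix (Fin n) (Fin p) ℝ) (y : Fin n → ℝ) (βt : Coef p)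
    (eta γ₂ : ℝ) (a : Fin p → ℝ) (β : Coef p) : ℝ :=
  1 / n * ‖WithLp.toLp 2 (y - X *ᵥ β.ofLp)‖ ^ 2
    + ∑ j, (a j * (|β j| / n) + eta / n * |βt j| ^ γ₂ * |β j - βt j|)

/-- The real numbers `a j` bound the weights `lam / |βt j| ^ γ₁ ∈ [0, ∞]` from below, and are equal
to them at the coordinates in `E`.  Replacing the weights by `a` leaves the objective unchanged at
the vectors that vanish outside `E`, and decreases it elsewhere. -/
structure IsWeightMinorant (lam γ₁ : ℝ) (βt : Coef p) (E : Finset (Fin p))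
    (a : Fin p → ℝ) : Prop where
  nonneg : ∀ j, 0 ≤ a j
  le_weight : ∀ j, ENNReal.ofReal (a j) ≤ ENNReal.ofReal lam * (ENNReal.ofReal (|βt j| ^ γ₁))⁻¹
  eq_weight : ∀ j ∈ E, ENNReal.ofReal (a j) = ENNReal.ofReal lam * (ENNReal.ofReal (|βt j| ^ γ₁))⁻¹

theorem objective_eq_add_sum (β : Coef p) :
    objective X y βt lam eta γ₁ γ₂ β =
      ENNReal.ofReal (1 / n * ‖WithLp.toLp 2 (y - X *ᵥ β.ofLp)‖ ^ 2) +
        ∑ j, (ENNReal.ofReal lam * (ENNReal.ofReal (|βt j| ^ γ₁))⁻¹ * ENNReal.ofReal (|β j| / n) +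
          ENNReal.ofReal (eta / n * |βt j| ^ γ₂ * |β j - βt j|)) := by
  rw [objective, Finset.sum_add_distrib, ← add_assoc, Finset.mul_sum, Finset.mul_sum]
  congr 1
  · refine congrArg _ (Finset.sum_congr rfl fun j _ => ?_)
    rw [div_eq_mul_inv, div_eq_mul_inv, ENNReal.ofReal_mul' (by positivity),
      ENNReal.ofReal_mul' (by positivity)]
    ring
  · refine Finset.sum_congr rfl fun j _ => ?_
    rw [ENNReal.ofReal_mul' (abs_nonneg _), ENNReal.ofReal_mul' (by positivity), mul_assoc]

theorem realObjective_nonneg (heta : 0 ≤ eta) (ha : ∀ j, 0 ≤ a j) (β : Coef p) :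
    0 ≤ realObjective X y βt eta γ₂ a β := by
  refine add_nonneg (by positivity) (Finset.sum_nonneg fun j _ => ?_)
  have := ha j
  positivity

theorem ofReal_realObjective (heta : 0 ≤ eta) (ha : ∀ j, 0 ≤ a j) (β : Coef p) :
    ENNReal.ofReal (realObjective X y βt eta γ₂ a β) =
      ENNReal.ofReal (1 / n * ‖WithLp.toLp 2 (y - X *ᵥ β.ofLp)‖ ^ 2) +
        ∑ j, (ENNReal.ofReal (a j) * ENNReal.ofReal (|β j| / n) +
          ENNReal.ofReal (eta / n * |βt j| ^ γ₂ * |β j - βt j|)) := by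
  have hlasso (j : Fin p) : 0 ≤ a j * (|β j| / n) := mul_nonneg (ha j) (by positivity)
  have htransfer (j : Fin p) : 0 ≤ eta / n * |βt j| ^ γ₂ * |β j - βt j| := by positivity
  have hterm (j : Fin p) := add_nonneg (hlasso j) (htransfer j)
  rw [realObjective, ENNReal.ofReal_add (by positivity) (Finset.sum_nonneg fun j _ => hterm j),
    ENNReal.ofReal_sum_of_nonneg fun j _ => hterm j]
  simp only [ENNReal.ofReal_add (hlasso _) (htransfer _), ENNReal.ofReal_mul (ha _)]

theorem IsEstimate.realObjective_le {βh b : Coef p}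
    (h : IsEstimate X y βt lam eta γ₁ γ₂ βh) (heta : 0 ≤ eta)
    (ha : IsWeightMinorant lam γ₁ βt E a) (hb : ∀ j ∉ E, b j = 0) :
    realObjective X y βt eta γ₂ a βh ≤ realObjective X y βt eta γ₂ a b := by
  rw [← ENNReal.ofReal_le_ofReal_iff (realObjective_nonneg heta ha.nonneg b)]
  calc ENNReal.ofReal (realObjective X y βt eta γ₂ a βh)
      ≤ objective X y βt lam eta γ₁ γ₂ βh := by
        rw [ofReal_realObjective heta ha.nonneg, objective_eq_add_sum]
        gcongr with j
        exact ha.le_weight j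
    _ ≤ objective X y βt lam eta γ₁ γ₂ b := h b
    _ = ENNReal.ofReal (realObjective X y βt eta γ₂ a b) := by
        rw [ofReal_realObjective heta ha.nonneg, objective_eq_add_sum]
        congr 2 with j
        by_cases hj : j ∈ E
        · rw [ha.eq_weight j hj]
        · simp [hb j hj]

theorem sq_mul_residual (X : Matrix (Fin n) (Fin p) ℝ) (βs β : Coef p) (e : Fin n → ℝ) (s : ℝ) :
    s ^ 2 * (1 / n * ‖WithLp.toLp 2 (response X βs e - X *ᵥ β.ofLp)‖ ^ 2) =
      s ^ 2 * (1 / n * ‖WithLp.toLp 2 e‖ ^ 2) + (quad (gram X) (s • (β - βs))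
        - 2 * ((s • (β - βs)).ofLp ⬝ᵥ ((s / √(n : ℝ)) • score X e).ofLp)) := by
  have hresidual : response X βs e - X *ᵥ β.ofLp = e - X *ᵥ (β - βs).ofLp := by
    rw [response, WithLp.ofLp_sub, Matrix.mulVec_sub]
    abel
  have hroot : 1 / √(n : ℝ) * (1 / √n) = 1 / n := by
    rw [one_div_mul_one_div, Real.mul_self_sqrt n.cast_nonneg]
  rw [hresidual, WithLp.toLp_sub, norm_sub_sq_real, quad_smul, quad_gram, dotProduct_eq_inner,
    real_inner_smul_left, real_inner_smul_right, real_inner_comm (score X e), inner_score,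
    WithLp.toLp_smul, real_inner_smul_right]
  linear_combination 2 * s ^ 2 *
    inner ℝ (WithLp.toLp 2 e) (WithLp.toLp 2 (X *ᵥ (β - βs).ofLp)) * hroot

/-- The penalty of the coordinate `j` as a function of the local parameter `s (β - βs)`, for the
objective multiplied by `s ^ 2`. -/
noncomputable def rescaledPenalty (n : ℕ) (s eta γ₂ : ℝ) (a : Fin p → ℝ) (βs βt : Coef p)
    (j : Fin p) : ℝ → ℝ :=
  shiftedPenalty (s * βs j) (s / n * a j) (s / n * (eta * |βt j| ^ γ₂)) (s * (βt j - βs j))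

/-- The local parameter at which a coordinate is pinned by the nonsmooth part of the dominating
penalty: the lasso penalty pins inactive coordinates at the value `0` of the coefficient, the
transfer penalty pins active ones at the initial estimate. -/
noncomputable def pinPoint (s : ℝ) (βs βt : Coef p) (j : Fin p) : ℝ :=
  if βs j = 0 then 0 else s * (βt j - βs j)

theorem tendsto_pinPoint {ι : Type*} {l : Filter ι} {s : ι → ℝ} {βs : Coef p} {βt : ι → Coef p}
    {j : Fin p} {d : ℝ} (hd : Tendsto (fun i => s i * (βt i j - βs j)) l (𝓝 d)) :
    Tendsto (fun i => pinPoint (s i) βs (βt i) j) l (𝓝 (if βs j = 0 then 0 else d)) := by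
  unfold pinPoint
  split_ifs with hj
  · exact tendsto_const_nhds
  · exact hd

/-- The excess of the dominating penalty of a coordinate over the other one: the rate at which the
penalty grows away from `pinPoint`. -/
noncomputable def pinSlope (n : ℕ) (s eta γ₂ : ℝ) (a : Fin p → ℝ) (βs βt : Coef p)
    (j : Fin p) : ℝ :=
  if βs j = 0 then s / n * a j - s / n * (eta * |βt j| ^ γ₂)
  else s / n * (eta * |βt j| ^ γ₂) - s / n * a j

theorem pinSlope_mul_le {s : ℝ} {βs : Coef p} (hs : 0 ≤ s) (heta : 0 ≤ eta) (ha : ∀ j, 0 ≤ a j)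
    (j : Fin p) (x : ℝ) :
    pinSlope n s eta γ₂ a βs βt j * |x - pinPoint s βs βt j| ≤
      rescaledPenalty n s eta γ₂ a βs βt j x
        - rescaledPenalty n s eta γ₂ a βs βt j (pinPoint s βs βt j) := by
  have ha := ha j
  by_cases hβ : βs j = 0
  · simp only [pinSlope, pinPoint, rescaledPenalty, hβ, if_true, mul_zero, sub_zero]
    exact sub_mul_abs_le_shiftedPenalty_zero _ _ _ (by positivity)
  · simp only [pinSlope, pinPoint, rescaledPenalty, hβ, if_false]
    exact sub_mul_abs_sub_le_shiftedPenalty _ _ _ _ (by positivity)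

theorem sq_mul_realObjective {s : ℝ} (hs : 0 ≤ s) (βs β : Coef p) (e : Fin n → ℝ) :
    s ^ 2 * realObjective X (response X βs e) βt eta γ₂ a β =
      s ^ 2 * (1 / n * ‖WithLp.toLp 2 e‖ ^ 2) + ∑ j, s / n * a j * |s * βs j| +
        penalizedQuad (gram X) ((s / √(n : ℝ)) • score X e) Finset.univ
          (rescaledPenalty n s eta γ₂ a βs βt) (s • (β - βs)) := by
  have hpenalty : s ^ 2 * ∑ j, (a j * (|β j| / n) + eta / n * |βt j| ^ γ₂ * |β j - βt j|) =
      ∑ j, s / n * a j * |s * βs j|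
        + ∑ j, rescaledPenalty n s eta γ₂ a βs βt j ((s • (β - βs)) j) := by
    rw [Finset.mul_sum, ← Finset.sum_add_distrib]
    refine Finset.sum_congr rfl fun j _ => ?_
    simp only [rescaledPenalty, shiftedPenalty, PiLp.smul_apply, PiLp.sub_apply, smul_eq_mul,
      ← mul_add, ← mul_sub, add_sub_cancel, sub_sub_sub_cancel_right, abs_mul, abs_of_nonneg hs]
    ring
  rw [realObjective, mul_add, sq_mul_residual, hpenalty, penalizedQuad]
  ring

theorem IsEstimate.penalizedQuad_le {s : ℝ} {βs βh v : Coef p} {e : Fin n → ℝ}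
    (h : IsEstimate X (response X βs e) βt lam eta γ₁ γ₂ βh) (hs : 0 < s) (heta : 0 ≤ eta)
    (ha : IsWeightMinorant lam γ₁ βt E a) (hv : ∀ j ∉ E, s * βs j + v j = 0) :
    penalizedQuad (gram X) ((s / √(n : ℝ)) • score X e) Finset.univ
        (rescaledPenalty n s eta γ₂ a βs βt) (s • (βh - βs)) ≤
      penalizedQuad (gram X) ((s / √(n : ℝ)) • score X e) Finset.univ
        (rescaledPenalty n s eta γ₂ a βs βt) v := by
  have hb : ∀ j ∉ E, (βs + s⁻¹ • v) j = 0 := fun j hj => by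
    rw [PiLp.add_apply, PiLp.smul_apply, smul_eq_mul, eq_neg_of_add_eq_zero_right (hv j hj)]
    field_simp
    ring
  have hle := mul_le_mul_of_nonneg_left (h.realObjective_le heta ha hb) (sq_nonneg s)
  rw [sq_mul_realObjective hs.le, sq_mul_realObjective hs.le, add_sub_cancel_left,
    smul_inv_smul₀ hs.ne'] at hle
  exact le_of_add_le_add_left hle

theorem penalizedQuad_univ (C : Matrix (Fin p) (Fin p) ℝ) (w : Coef p) (T : Finset (Fin p))
    (h : Fin p → ℝ → ℝ) (v : Coef p) :
    penalizedQuad C w Finset.univ h v = penalizedQuad C w T h v + ∑ j ∈ Tᶜ, h j (v j) := by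
  rw [penalizedQuad, ← Finset.sum_add_sum_compl T, ← add_assoc, ← penalizedQuad]

end Reduction

/-- The local parameter that equals the rescaled initial error at the coordinates in `E` and
vanishes outside `E`. -/
noncomputable def transferPoint {p : ℕ} (E : Finset (Fin p)) (s : ℝ) (βs βt : Coef p) : Coef p :=
  WithLp.toLp 2 fun j => if j ∈ E then s * (βt j - βs j) else 0

/-- Twice the `ℓ¹` distance of `transferPoint E s βs βt` to the rescaled initial error: the loss in
the penalty bounds that is due to the coordinates outside `E`. -/
noncomputable def transferSlack {p : ℕ} (E : Finset (Fin p)) (s : ℝ) (βs βt : Coef p) : ℝ :=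
  ∑ j ∈ Eᶜ, 2 * |s * (βt j - βs j)|

section Transfer

variable {p n : ℕ} {E : Finset (Fin p)} {s eta γ₂ κ : ℝ} {a : Fin p → ℝ}
  {βs βt : Coef p} {j : Fin p}

theorem transferSlack_nonneg : 0 ≤ transferSlack E s βs βt :=
  Finset.sum_nonneg fun _ _ => by positivity

theorem mul_abs_sub_transferPoint_le_of_mem (hs : 0 ≤ s) (ha : 0 ≤ a j) (hj : j ∈ E)
    (hκ : κ ≤ eta * |βt j| ^ γ₂ - a j) (x : ℝ) :
    s / n * κ * |x - transferPoint E s βs βt j| ≤ rescaledPenalty n s eta γ₂ a βs βt j x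
      - rescaledPenalty n s eta γ₂ a βs βt j (transferPoint E s βs βt j) := by
  simp only [transferPoint, if_pos hj, rescaledPenalty]
  refine le_trans ?_ (sub_mul_abs_sub_le_shiftedPenalty _ _ _ _ (by positivity))
  rw [← mul_sub]
  gcongr

theorem mul_abs_sub_transferPoint_le_of_notMem (hs : 0 ≤ s) (heta : 0 ≤ eta) (ha : 0 ≤ a j)
    (hj : j ∉ E) (hβs : βs j = 0) (x : ℝ) :
    s / n * (eta * |βt j| ^ γ₂) * |x - transferPoint E s βs βt j| ≤
      rescaledPenalty n s eta γ₂ a βs βt j x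
        - rescaledPenalty n s eta γ₂ a βs βt j (transferPoint E s βs βt j)
        + s / n * (eta * |βt j| ^ γ₂) * transferSlack E s βs βt := by
  have hslack : 2 * |s * (βt j - βs j)| ≤ transferSlack E s βs βt :=
    Finset.single_le_sum (f := fun k => 2 * |s * (βt k - βs k)|) (fun _ _ => by positivity)
      (Finset.mem_compl.2 hj)
  have hB : 0 ≤ s / n * (eta * |βt j| ^ γ₂) := by positivity
  have hle := mul_sub_le_shiftedPenalty_zero (s * (βt j - βs j)) x
    (by positivity : 0 ≤ s / n * a j) hB
  simp only [transferPoint, if_neg hj, rescaledPenalty, sub_zero]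
  rw [show s * βs j = 0 by rw [hβs, mul_zero]]
  nlinarith [mul_le_mul_of_nonneg_left hslack hB]

theorem mul_abs_sub_transferPoint_le {κ : Fin p → ℝ} {θ : ℝ} (hs : 0 ≤ s) (heta : 0 ≤ eta)
    (hθ : 0 ≤ θ) (ha : ∀ j, 0 ≤ a j) (hmem : ∀ j ∈ E, κ j * θ ≤ eta * |βt j| ^ γ₂ - a j)
    (hnotMem : ∀ j ∉ E, βs j = 0 ∧ κ j = 1 ∧ θ = eta * |βt j| ^ γ₂) (j : Fin p) (x : ℝ) :
    κ j * (s / n * θ) * |x - transferPoint E s βs βt j| ≤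
      rescaledPenalty n s eta γ₂ a βs βt j x
        - rescaledPenalty n s eta γ₂ a βs βt j (transferPoint E s βs βt j)
        + s / n * θ * transferSlack E s βs βt := by
  by_cases hj : j ∈ E
  · rw [mul_left_comm]
    exact (mul_abs_sub_transferPoint_le_of_mem hs (ha j) hj (hmem j hj) x).trans
      (le_add_of_nonneg_right (mul_nonneg (by positivity) transferSlack_nonneg))
  · obtain ⟨hβs, hκ, hθ⟩ := hnotMem j hj
    rw [hκ, one_mul, hθ]
    exact mul_abs_sub_transferPoint_le_of_notMem hs heta (ha j) hj hβs x

end Transfer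

theorem mem_active {p : ℕ} {β : Coef p} {j : Fin p} : j ∈ active β ↔ β j ≠ 0 := by
  simp [active]

theorem sqrt_rpow_mul_abs_rpow (m : ℕ) (γ x : ℝ) :
    √((m : ℝ) ^ γ) * |x| ^ γ = |√(m : ℝ) * x| ^ γ := by
  rw [abs_mul, abs_of_nonneg (Real.sqrt_nonneg _),
    Real.mul_rpow (Real.sqrt_nonneg _) (abs_nonneg _), Real.sqrt_eq_rpow,
    Real.sqrt_eq_rpow, ← Real.rpow_mul m.cast_nonneg,
    ← Real.rpow_mul m.cast_nonneg, mul_comm γ]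

theorem abs_rpow_pos {x γ : ℝ} (h : x ≠ 0 ∨ γ = 0) : 0 < |x| ^ γ := by
  rcases h with hx | rfl
  · exact Real.rpow_pos_of_pos (abs_pos.2 hx) _
  · simp

section Minorant

variable {p : ℕ} {E : Finset (Fin p)} {lam γ₁ t : ℝ} {βt : Coef p}

/-- The weights `lam / |βt j| ^ γ₁` with `t` in place of `|βt j| ^ γ₁` at the coordinates outside
`E`.  For `t > 0` they are finite there, and the bound `|βt j| ^ γ₁ ≤ t` makes them minorants. -/
noncomputable def minorantWeight (E : Finset (Fin p)) (lam γ₁ t : ℝ) (βt : Coef p) (j : Fin p) :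
    ℝ :=
  if j ∈ E then lam / |βt j| ^ γ₁ else lam / t

theorem isWeightMinorant_minorantWeight (hlam : 0 ≤ lam) (ht : 0 < t)
    (hE : ∀ j ∈ E, 0 < |βt j| ^ γ₁) (hle : ∀ j ∉ E, |βt j| ^ γ₁ ≤ t) :
    IsWeightMinorant lam γ₁ βt E (minorantWeight E lam γ₁ t βt) where
  nonneg j := by
    rw [minorantWeight]
    split_ifs <;> positivity
  le_weight j := by
    rw [minorantWeight]
    split_ifs with hj
    · rw [ENNReal.ofReal_div_of_pos (hE j hj), div_eq_mul_inv]
    · rw [ENNReal.ofReal_div_of_pos ht, div_eq_mul_inv]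
      gcongr
      exact hle j hj
  eq_weight j hj := by
    rw [minorantWeight, if_pos hj, ENNReal.ofReal_div_of_pos (hE j hj), div_eq_mul_inv]

theorem minorantWeight_of_mem {j : Fin p} (hj : j ∈ E) :
    minorantWeight E lam γ₁ t βt j = lam / |βt j| ^ γ₁ :=
  if_pos hj

theorem minorantWeight_of_notMem {j : Fin p} (hj : j ∉ E) :
    minorantWeight E lam γ₁ t βt j = lam / t :=
  if_neg hj

end Minorant

section LimitObjective

variable {p : ℕ} (C : Matrix (Fin p) (Fin p) ℝ) (βs w : Coef p) (γ₁ γ₂ l η : ℝ)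

theorem pinned_univ (c : Coef p) : pinned Finset.univ c = Set.univ := by
  ext
  simp [pinned]

theorem pinned_compl (T : Finset (Fin p)) (c : Coef p) :
    pinned Tᶜ c = {v | ∀ j ∈ T, v j = c j} := by
  simp only [pinned, Finset.mem_compl, not_not]

theorem penalizedQuad_free (hη : γ₂ = 0 → η = 0) (x d : Fin p → ℝ) :
    (penalizedQuad C w Finset.univ fun j =>
      limitPenalty (βs j) (if βs j = 0 then l / |x j| ^ γ₁ else 0) (η * |βs j| ^ γ₂) (d j)) =
    fun u => quad C u - 2 * (u.ofLp ⬝ᵥ w.ofLp) + ∑ j ∈ (active βs)ᶜ, l / |x j| ^ γ₁ * |u j|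
      + ∑ j ∈ active βs, η * |βs j| ^ γ₂ * |u j - d j| := by
  funext u
  rw [penalizedQuad, add_assoc, ← Finset.sum_compl_add_sum (active βs)]
  congr 2
  · refine Finset.sum_congr rfl fun j hj => ?_
    have hj : βs j = 0 := by simpa [mem_active] using hj
    have hB : η * |βs j| ^ γ₂ = 0 := by
      by_cases hγ : γ₂ = 0
      · rw [hη hγ, zero_mul]
      · rw [hj, abs_zero, Real.zero_rpow hγ, mul_zero]
    rw [limitPenalty, hB, if_pos hj, hj, absDeriv_zero, zero_mul, add_zero]
  · refine Finset.sum_congr rfl fun j hj => ?_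
    rw [limitPenalty, if_neg (mem_active.1 hj), zero_mul, zero_add]

theorem penalizedQuad_active_compl (A B d : Fin p → ℝ) :
    penalizedQuad C w (active βs)ᶜ (fun j => limitPenalty (βs j) (A j) (B j) (d j)) =
    fun u => quad C u - 2 * (u.ofLp ⬝ᵥ w.ofLp)
      + ∑ j ∈ (active βs)ᶜ, (A j * |u j| + B j * |u j - d j|) := by
  funext u
  rw [penalizedQuad]
  congr 1
  refine Finset.sum_congr rfl fun j hj => ?_
  have hj : βs j = 0 := by simpa [mem_active] using hj
  rw [limitPenalty, hj, absDeriv_zero]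

theorem penalizedQuad_active (B d : Fin p → ℝ) :
    (penalizedQuad C w (active βs) fun j =>
      limitPenalty (βs j) (l / |βs j| ^ γ₁) (B j) (d j)) =
    fun u => quad C u - 2 * (u.ofLp ⬝ᵥ w.ofLp) + ∑ j ∈ active βs,
      (l * (SignType.sign (βs j) / |βs j| ^ γ₁) * u j + B j * |u j - d j|) := by
  funext u
  rw [penalizedQuad]
  congr 1
  refine Finset.sum_congr rfl fun j hj => ?_
  rw [limitPenalty, absDeriv_of_ne_zero (mem_active.1 hj)]
  ring

variable {C}

theorem exists_aemeasurable_isArgmin {Ω : Type*} [MeasurableSpace Ω] {P : Measure Ω}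
    (hC : C.PosDef) (T : Finset (Fin p)) (b : Fin p → ℝ) {A B d : Ω → Fin p → ℝ}
    {w c : Ω → Coef p} (hA : AEMeasurable A P) (hB : AEMeasurable B P) (hd : AEMeasurable d P)
    (hw : AEMeasurable w P) (hc : AEMeasurable c P) (hA0 : ∀ ω, 0 ≤ A ω) (hB0 : ∀ ω, 0 ≤ B ω) :
    ∃ G : Ω → Coef p, AEMeasurable G P ∧ ∀ ω, IsArgmin (pinned T (c ω))
      (penalizedQuad C (w ω) T fun j => limitPenalty (b j) (A ω j) (B ω j) (d ω j)) (G ω) := by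
  obtain ⟨G, hG, hmin⟩ := exists_continuous_isArgmin hC T b
    (Q := (Fin p → ℝ) × (Fin p → ℝ) × (Fin p → ℝ) × Coef p × Coef p)
    (A := fun q j => |q.1 j|) (B := fun q j => |q.2.1 j|) (d := fun q => q.2.2.1)
    (w := fun q => q.2.2.2.1) (c := fun q => q.2.2.2.2) (by fun_prop) (by fun_prop)
    (by fun_prop) (by fun_prop) (by fun_prop) (fun q j => abs_nonneg _) fun q j => abs_nonneg _
  refine ⟨fun ω => G (A ω, B ω, d ω, w ω, c ω), hG.measurable.comp_aemeasurable
    (hA.prodMk (hB.prodMk (hd.prodMk (hw.prodMk hc)))), fun ω => ?_⟩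
  simpa only [abs_of_nonneg (hA0 ω _), abs_of_nonneg (hB0 ω _)] using
    hmin (A ω, B ω, d ω, w ω, c ω)

end LimitObjective

theorem sqrt_div_self_mul (x y : ℝ) : √x / x * y = y / √x := by
  rw [Real.sqrt_div_self', one_div_mul_eq_div]

theorem sqrt_div_self_mul_mul_sqrt {x t : ℝ} (y : ℝ) (ht : 0 ≤ t) :
    √x / x * y * √t = √(t / x) * y := by
  rw [sqrt_div_self_mul, Real.sqrt_div ht]
  ring

/-- Realizations of adaptive transfer lasso estimates `βh i` with sample sizes `N i` and `m i`,
along which the rescaled initial errors converge to `z` and the score vectors to `w`. -/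
structure IsEstimateSeq {p : ℕ} (βs : Coef p) (γ₁ γ₂ r₀ : ℝ) (C : Matrix (Fin p) (Fin p) ℝ)
    (z w : Coef p) (N m : ℕ → ℕ) (X : (i : ℕ) → Matrix (Fin (N i)) (Fin p) ℝ)
    (e : (i : ℕ) → Fin (N i) → ℝ) (lam eta : ℕ → ℝ) (βt βh : ℕ → Coef p) : Prop where
  posDef : C.PosDef
  gamma₁_nonneg : 0 ≤ γ₁
  gamma₂_nonneg : 0 ≤ γ₂
  tendsto_size : Tendsto N atTop atTop
  source_pos : ∀ᶠ i in atTop, 0 < m i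
  tendsto_ratio : Tendsto (fun i => (N i : ℝ) / m i) atTop (𝓝 r₀)
  tendsto_gram : Tendsto (fun i => gram (X i)) atTop (𝓝 C)
  tendsto_score : Tendsto (fun i => score (X i) (e i)) atTop (𝓝 w)
  tendsto_initial : Tendsto (fun i => √(m i : ℝ) • (βt i - βs)) atTop (𝓝 z)
  lam_nonneg : ∀ i, 0 ≤ lam i
  eta_nonneg : ∀ i, 0 ≤ eta i
  isEstimate : ∀ i, IsEstimate (X i) (response (X i) βs (e i)) (βt i) (lam i) (eta i) γ₁ γ₂ (βh i)

namespace IsEstimateSeq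

variable {p : ℕ} {βs : Coef p} {γ₁ γ₂ r₀ : ℝ} {C : Matrix (Fin p) (Fin p) ℝ} {z w : Coef p}
  {N m : ℕ → ℕ} {X : (i : ℕ) → Matrix (Fin (N i)) (Fin p) ℝ} {e : (i : ℕ) → Fin (N i) → ℝ}
  {lam eta : ℕ → ℝ} {βt βh : ℕ → Coef p} {γ : ℝ} {j : Fin p}
  (H : IsEstimateSeq βs γ₁ γ₂ r₀ C z w N m X e lam eta βt βh)

include H

theorem tendsto_sqrt_size : Tendsto (fun i => √(N i : ℝ)) atTop atTop :=
  Real.tendsto_sqrt_atTop.comp (tendsto_natCast_atTop_atTop.comp H.tendsto_size)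

theorem tendsto_source : Tendsto (fun i => (m i : ℝ)) atTop atTop := by
  have hN : Tendsto (fun i => (N i : ℝ)) atTop atTop :=
    tendsto_natCast_atTop_atTop.comp H.tendsto_size
  refine tendsto_atTop_mono' _ ?_ (hN.atTop_div_const (by positivity : 0 < |r₀| + 1))
  filter_upwards
    [H.tendsto_ratio.eventually_le_const (lt_add_of_le_of_pos (le_abs_self r₀) one_pos),
    H.source_pos] with i hratio hm
  rwa [div_le_comm₀ (by positivity) (by positivity)]

theorem tendsto_sqrt_source_rpow (hγ : 0 < γ) : Tendsto (fun i => √((m i : ℝ) ^ γ)) atTop atTop :=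
  Real.tendsto_sqrt_atTop.comp ((tendsto_rpow_atTop hγ).comp H.tendsto_source)

theorem eventually_one_le_sqrt_source_rpow (hγ : 0 ≤ γ) :
    ∀ᶠ i in atTop, 1 ≤ √((m i : ℝ) ^ γ) := by
  filter_upwards [H.tendsto_source.eventually_ge_atTop 1] with i hi
  exact Real.one_le_sqrt.2 (Real.one_le_rpow hi hγ)

theorem tendsto_initial_apply (j : Fin p) :
    Tendsto (fun i => √(m i : ℝ) * (βt i j - βs j)) atTop (𝓝 (z j)) :=
  tendsto_coef_apply H.tendsto_initial j

theorem tendsto_initial_coef (j : Fin p) : Tendsto (fun i => βt i j) atTop (𝓝 (βs j)) := by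
  have hroot : Tendsto (fun i => √(m i : ℝ)) atTop atTop :=
    Real.tendsto_sqrt_atTop.comp H.tendsto_source
  refine tendsto_sub_nhds_zero_iff.1 (((H.tendsto_initial_apply j).div_atTop hroot).congr' ?_)
  filter_upwards [hroot.eventually_ne_atTop 0] with i hi
  rw [mul_div_cancel_left₀ _ hi]

theorem tendsto_abs_initial_rpow (hγ : 0 ≤ γ) (j : Fin p) :
    Tendsto (fun i => |βt i j| ^ γ) atTop (𝓝 (|βs j| ^ γ)) :=
  (H.tendsto_initial_coef j).abs.rpow_const (Or.inr hγ)

theorem tendsto_abs_scaled_rpow (hγ : 0 ≤ γ) (j : Fin p) :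
    Tendsto (fun i => |√(m i : ℝ) * (βt i j - βs j)| ^ γ) atTop (𝓝 (|z j| ^ γ)) :=
  (H.tendsto_initial_apply j).abs.rpow_const (Or.inr hγ)

theorem eventually_abs_initial_rpow_pos (hj : βs j ≠ 0 ∨ z j ≠ 0 ∨ γ = 0) :
    ∀ᶠ i in atTop, 0 < |βt i j| ^ γ := by
  by_cases hβ : βs j = 0
  · rcases hj.resolve_left (not_not.2 hβ) with hz | hγ
    · filter_upwards [(H.tendsto_initial_apply j).eventually_ne hz] with i hi
      rw [hβ, sub_zero] at hi
      exact abs_rpow_pos (Or.inl (right_ne_zero_of_mul hi))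
    · exact Eventually.of_forall fun i => abs_rpow_pos (Or.inr hγ)
  · exact ((H.tendsto_initial_coef j).eventually_ne hβ).mono fun i hi => abs_rpow_pos (Or.inl hi)

theorem eventually_isWeightMinorant {E : Finset (Fin p)}
    (hE : ∀ j ∈ E, βs j ≠ 0 ∨ z j ≠ 0 ∨ γ₁ = 0) (hEc : ∀ j ∉ E, βs j = 0) :
    ∀ᶠ i in atTop, IsWeightMinorant (lam i) γ₁ (βt i) E
      (minorantWeight E (lam i) γ₁ ((‖z‖ + 1) ^ γ₁ / √((m i : ℝ) ^ γ₁)) (βt i)) := by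
  have hpos : ∀ᶠ i in atTop, ∀ j ∈ E, 0 < |βt i j| ^ γ₁ :=
    (Finset.eventually_all E).2 fun j hj => H.eventually_abs_initial_rpow_pos (hE j hj)
  have hle : ∀ᶠ i in atTop, ‖√(m i : ℝ) • (βt i - βs)‖ ≤ ‖z‖ + 1 :=
    H.tendsto_initial.norm.eventually_le_const (lt_add_one _)
  filter_upwards [hpos, hle, H.source_pos] with i hpos hle hm
  have hroot : 0 < √((m i : ℝ) ^ γ₁) := by positivity
  refine isWeightMinorant_minorantWeight (H.lam_nonneg i) (by positivity) hpos fun j hj => ?_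
  have hcoord := (abs_apply_le_norm _ j).trans hle
  rw [PiLp.smul_apply, PiLp.sub_apply, hEc j hj, sub_zero, smul_eq_mul] at hcoord
  rw [le_div_iff₀' hroot, sqrt_rpow_mul_abs_rpow]
  exact Real.rpow_le_rpow (abs_nonneg _) hcoord H.gamma₁_nonneg

theorem tendsto_sqrt_size_mul_initial (j : Fin p) :
    Tendsto (fun i => √(N i : ℝ) * (βt i j - βs j)) atTop (𝓝 (√r₀ * z j)) := by
  refine (H.tendsto_ratio.sqrt.mul (H.tendsto_initial_apply j)).congr' ?_
  filter_upwards [H.source_pos] with i hi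
  have hm : √(m i : ℝ) ≠ 0 := by positivity
  rw [Real.sqrt_div (Nat.cast_nonneg _), ← mul_assoc, div_mul_cancel₀ _ hm]

section Scale

variable {E T : Finset (Fin p)} {s : ℕ → ℝ} {a : ℕ → Fin p → ℝ} {τ : ℝ} {A B : Fin p → ℝ}

theorem tendsto_mul_initial (hτ : Tendsto (fun i => s i / √(N i : ℝ)) atTop (𝓝 τ)) (j : Fin p) :
    Tendsto (fun i => s i * (βt i j - βs j)) atTop (𝓝 (τ * (√r₀ * z j))) := by
  refine (hτ.mul (H.tendsto_sqrt_size_mul_initial j)).congr' ?_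
  filter_upwards [H.tendsto_sqrt_size.eventually_ne_atTop 0] with i hi
  rw [← mul_assoc, div_mul_cancel₀ _ hi]

theorem penalizedQuadTendsto (hs : Tendsto s atTop atTop)
    (hτ : Tendsto (fun i => s i / √(N i : ℝ)) atTop (𝓝 τ)) (ha : ∀ᶠ i in atTop, ∀ j, 0 ≤ a i j)
    (hA : ∀ j ∈ T, Tendsto (fun i => s i / N i * a i j) atTop (𝓝 (A j)))
    (hB : ∀ j ∈ T, Tendsto (fun i => s i / N i * (eta i * |βt i j| ^ γ₂)) atTop (𝓝 (B j))) :
    PenalizedQuadTendsto atTop T (fun i => gram (X i))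
      (fun i => (s i / √(N i : ℝ)) • score (X i) (e i))
      (fun i => rescaledPenalty (N i) (s i) (eta i) γ₂ (a i) βs (βt i)) C (τ • w)
      (fun j => limitPenalty (βs j) (A j) (B j) (τ * (√r₀ * z j))) where
  posDef := H.posDef
  tendsto_matrix := H.tendsto_gram
  tendsto_linear := hτ.smul H.tendsto_score
  tendsto_penalty j hj x := tendsto_shiftedPenalty (βs j) hs (hA j hj) (hB j hj)
    (H.tendsto_mul_initial hτ j) x
  le_penalty := by
    have hA_le : ∀ᶠ i in atTop, ∀ j ∈ T, s i / N i * a i j ≤ |A j| + 1 :=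
      (Finset.eventually_all T).2 fun j hj =>
        (hA j hj).eventually_le_const (lt_add_of_le_of_pos (le_abs_self _) one_pos)
    refine ⟨∑ j ∈ T, (|A j| + 1), by positivity, ?_⟩
    filter_upwards [hA_le, ha, hs.eventually_ge_atTop 0] with i hA_le ha hs j hj x
    have heta := H.eta_nonneg i
    refine neg_mul_le_shiftedPenalty _ _ x (mul_nonneg (by positivity) (ha j))
      ((hA_le j hj).trans ?_) (by positivity)
    exact Finset.single_le_sum (f := fun j => |A j| + 1) (fun _ _ => by positivity) hj

theorem tendsto_smul_sub (hs : Tendsto s atTop atTop)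
    (hτ : Tendsto (fun i => s i / √(N i : ℝ)) atTop (𝓝 τ))
    (ha : ∀ᶠ i in atTop, IsWeightMinorant (lam i) γ₁ (βt i) E (a i))
    (hE : ∀ j ∉ E, j ∉ T ∧ βs j = 0)
    (hA : ∀ j ∈ T, Tendsto (fun i => s i / N i * a i j) atTop (𝓝 (A j)))
    (hB : ∀ j ∈ T, Tendsto (fun i => s i / N i * (eta i * |βt i j| ^ γ₂)) atTop (𝓝 (B j)))
    (hslope : ∀ j ∉ T,
      Tendsto (fun i => pinSlope (N i) (s i) (eta i) γ₂ (a i) βs (βt i) j) atTop atTop)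
    {c u₀ : Coef p} (hc : ∀ j ∉ T, c j = if βs j = 0 then 0 else τ * (√r₀ * z j))
    (hu₀ : IsArgmin (pinned T c)
      (penalizedQuad C (τ • w) T fun j => limitPenalty (βs j) (A j) (B j) (τ * (√r₀ * z j))) u₀) :
    Tendsto (fun i => s i • (βh i - βs)) atTop (𝓝 u₀) := by
  let cs (i : ℕ) : Coef p := WithLp.toLp 2 fun j =>
    if j ∈ T then c j else pinPoint (s i) βs (βt i) j
  have hcs : Tendsto cs atTop (𝓝 c) := by
    refine ((PiLp.continuous_toLp 2 fun _ : Fin p => ℝ).tendsto c.ofLp).comp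
      (tendsto_pi_nhds.2 fun j => ?_)
    by_cases hj : j ∈ T
    · simp [hj]
    · simpa only [hj, if_false, hc j hj] using tendsto_pinPoint (H.tendsto_mul_initial hτ j)
  refine (H.penalizedQuadTendsto hs hτ (ha.mono fun i hi => hi.nonneg) hA hB
    ).tendsto_of_slope_tendsto_atTop hu₀ hcs hslope ?_
  filter_upwards [ha, hs.eventually_gt_atTop 0] with i ha hs v hv
  have hv_eq (j : Fin p) (hj : j ∉ T) : v j = pinPoint (s i) βs (βt i) j := by
    rw [hv j hj]
    exact if_neg hj
  have hle := (H.isEstimate i).penalizedQuad_le hs (H.eta_nonneg i) ha (v := v) fun j hj => by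
    simp [hv_eq j (hE j hj).1, pinPoint, (hE j hj).2]
  rw [penalizedQuad_univ _ _ T, penalizedQuad_univ _ _ T] at hle
  have hpin : ∑ j ∈ Tᶜ, pinSlope (N i) (s i) (eta i) γ₂ (a i) βs (βt i) j *
        |(s i • (βh i - βs)) j - cs i j| ≤
      ∑ j ∈ Tᶜ, (rescaledPenalty (N i) (s i) (eta i) γ₂ (a i) βs (βt i) j ((s i • (βh i - βs)) j)
        - rescaledPenalty (N i) (s i) (eta i) γ₂ (a i) βs (βt i) j (v j)) :=
    Finset.sum_le_sum fun j hj => by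
      rw [← hv j (Finset.mem_compl.1 hj), hv_eq j (Finset.mem_compl.1 hj)]
      exact pinSlope_mul_le hs.le (H.eta_nonneg i) ha.nonneg j _
  rw [Finset.sum_sub_distrib] at hpin
  linarith

end Scale

section Weights

variable {s : ℕ → ℝ} {l η : ℝ}

theorem tendsto_lam_of_tendsto_mul_sqrt_source_rpow
    (hlam : Tendsto (fun i => s i / N i * lam i * √((m i : ℝ) ^ γ₁)) atTop (𝓝 l)) :
    Tendsto (fun i => s i / N i * lam i) atTop (𝓝 (if γ₁ = 0 then l else 0)) := by
  split_ifs with hγ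
  · simpa [hγ] using hlam
  · have hroot := H.tendsto_sqrt_source_rpow (H.gamma₁_nonneg.lt_of_ne' hγ)
    refine (hlam.div_atTop hroot).congr' ?_
    filter_upwards [hroot.eventually_ne_atTop 0] with i hi
    rw [mul_div_cancel_right₀ _ hi]

theorem tendsto_lasso_weight (hlam : Tendsto (fun i => s i / N i * lam i) atTop (𝓝 l))
    (hj : βs j ≠ 0) :
    Tendsto (fun i => s i / N i * (lam i / |βt i j| ^ γ₁)) atTop (𝓝 (l / |βs j| ^ γ₁)) := by
  simp only [← mul_div_assoc]
  exact hlam.div (H.tendsto_abs_initial_rpow H.gamma₁_nonneg j)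
    (abs_rpow_pos (Or.inl hj)).ne'

theorem eventually_abs_initial_rpow_eq (γ : ℝ) (hj : βs j = 0) :
    ∀ᶠ i in atTop, |βt i j| ^ γ = |√(m i : ℝ) * (βt i j - βs j)| ^ γ / √((m i : ℝ) ^ γ) := by
  filter_upwards [H.source_pos] with i hi
  rw [hj, sub_zero, ← sqrt_rpow_mul_abs_rpow, mul_div_cancel_left₀ _ (by positivity)]

theorem tendsto_lasso_weight_of_eq_zero
    (hlam : Tendsto (fun i => s i / N i * lam i * √((m i : ℝ) ^ γ₁)) atTop (𝓝 l))
    (hj : βs j = 0) (hz : z j ≠ 0 ∨ γ₁ = 0) :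
    Tendsto (fun i => s i / N i * (lam i / |βt i j| ^ γ₁)) atTop (𝓝 (l / |z j| ^ γ₁)) := by
  refine (hlam.div (H.tendsto_abs_scaled_rpow H.gamma₁_nonneg j) (abs_rpow_pos hz).ne').congr' ?_
  filter_upwards [H.eventually_abs_initial_rpow_eq γ₁ hj] with i hi
  rw [Pi.div_apply, hi, div_div_eq_mul_div, ← mul_div_assoc, mul_assoc]

theorem tendsto_transfer_weight (heta : Tendsto (fun i => s i / N i * eta i) atTop (𝓝 η))
    (j : Fin p) :
    Tendsto (fun i => s i / N i * (eta i * |βt i j| ^ γ₂)) atTop (𝓝 (η * |βs j| ^ γ₂)) := by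
  simp only [← mul_assoc]
  exact heta.mul (H.tendsto_abs_initial_rpow H.gamma₂_nonneg j)

theorem tendsto_transfer_weight_of_eq_zero
    (heta : Tendsto (fun i => s i / N i * eta i / √((m i : ℝ) ^ γ₂)) atTop (𝓝 η))
    (hj : βs j = 0) :
    Tendsto (fun i => s i / N i * (eta i * |βt i j| ^ γ₂)) atTop (𝓝 (η * |z j| ^ γ₂)) := by
  refine (heta.mul (H.tendsto_abs_scaled_rpow H.gamma₂_nonneg j)).congr' ?_
  filter_upwards [H.eventually_abs_initial_rpow_eq γ₂ hj] with i hi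
  rw [hi]
  ring

end Weights

section Regimes

variable {s : ℕ → ℝ} {τ l η : ℝ} {u₀ : Coef p} (hs : Tendsto s atTop atTop)
  (hτ : Tendsto (fun i => s i / √(N i : ℝ)) atTop (𝓝 τ))

include hs hτ

theorem tendsto_smul_sub_of_free (hl : γ₁ = 0 → l = 0)
    (hz : ∀ j, βs j = 0 → z j ≠ 0 ∨ γ₁ = 0)
    (hlam : Tendsto (fun i => s i / N i * lam i * √((m i : ℝ) ^ γ₁)) atTop (𝓝 l))
    (heta : Tendsto (fun i => s i / N i * eta i) atTop (𝓝 η))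
    (hu₀ : IsArgmin (pinned Finset.univ 0) (penalizedQuad C (τ • w) Finset.univ fun j =>
      limitPenalty (βs j) (if βs j = 0 then l / |z j| ^ γ₁ else 0) (η * |βs j| ^ γ₂)
        (τ * (√r₀ * z j))) u₀) :
    Tendsto (fun i => s i • (βh i - βs)) atTop (𝓝 u₀) := by
  refine H.tendsto_smul_sub hs hτ (H.eventually_isWeightMinorant (E := Finset.univ)
    (fun j _ => or_iff_not_imp_left.2 fun hj => hz j (not_not.1 hj))
    fun j hj => absurd (Finset.mem_univ j) hj) (fun j hj => absurd (Finset.mem_univ j) hj)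
    (fun j hj => ?_) (fun j _ => H.tendsto_transfer_weight heta j)
    (fun j hj => absurd (Finset.mem_univ j) hj) (fun j hj => absurd (Finset.mem_univ j) hj) hu₀
  simp only [minorantWeight_of_mem hj]
  split_ifs with hβ
  · exact H.tendsto_lasso_weight_of_eq_zero hlam hβ (hz j hβ)
  · have hlam₀ : Tendsto (fun i => s i / N i * lam i) atTop (𝓝 0) := by
      simpa +contextual [hl] using H.tendsto_lam_of_tendsto_mul_sqrt_source_rpow hlam
    simpa only [zero_div] using H.tendsto_lasso_weight hlam₀ hβ

theorem tendsto_smul_sub_of_active_pinned (hz : ∀ j, βs j = 0 → z j ≠ 0 ∨ γ₁ = 0)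
    (hlam : Tendsto (fun i => s i / N i * lam i * √((m i : ℝ) ^ γ₁)) atTop (𝓝 l))
    (heta : Tendsto (fun i => s i / N i * eta i) atTop atTop)
    (heta_inactive : Tendsto (fun i => s i / N i * eta i / √((m i : ℝ) ^ γ₂)) atTop (𝓝 η))
    (hu₀ : IsArgmin (pinned (active βs)ᶜ (WithLp.toLp 2 fun j => τ * (√r₀ * z j)))
      (penalizedQuad C (τ • w) (active βs)ᶜ fun j =>
        limitPenalty (βs j) (l / |z j| ^ γ₁) (η * |z j| ^ γ₂) (τ * (√r₀ * z j))) u₀) :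
    Tendsto (fun i => s i • (βh i - βs)) atTop (𝓝 u₀) := by
  have hfree {j : Fin p} (hj : j ∈ (active βs)ᶜ) : βs j = 0 := by simpa [mem_active] using hj
  have hpinned {j : Fin p} (hj : j ∉ (active βs)ᶜ) : βs j ≠ 0 := by simpa [mem_active] using hj
  refine H.tendsto_smul_sub hs hτ (H.eventually_isWeightMinorant (E := Finset.univ)
    (fun j _ => or_iff_not_imp_left.2 fun hj => hz j (not_not.1 hj))
    fun j hj => absurd (Finset.mem_univ j) hj) (fun j hj => absurd (Finset.mem_univ j) hj)
    (fun j hj => ?_) (fun j hj => H.tendsto_transfer_weight_of_eq_zero heta_inactive (hfree hj))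
    (fun j hj => ?_) (fun j hj => (if_neg (hpinned hj)).symm) hu₀
  · simp only [minorantWeight_of_mem (Finset.mem_univ j)]
    exact H.tendsto_lasso_weight_of_eq_zero hlam (hfree hj) (hz j (hfree hj))
  · have hj := hpinned hj
    have hlasso := H.tendsto_lasso_weight (H.tendsto_lam_of_tendsto_mul_sqrt_source_rpow hlam) hj
    have htransfer := heta.atTop_mul_pos (abs_rpow_pos (Or.inl hj))
      (H.tendsto_abs_initial_rpow H.gamma₂_nonneg j)
    simpa only [pinSlope, hj, if_false, minorantWeight_of_mem (Finset.mem_univ j), mul_assoc,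
      sub_eq_add_neg] using htransfer.atTop_add hlasso.neg

theorem tendsto_smul_sub_of_inactive_pinned
    (hlam : Tendsto (fun i => s i / N i * lam i) atTop (𝓝 l))
    (hlam_inactive : Tendsto (fun i => s i / N i * lam i * √((m i : ℝ) ^ γ₁)) atTop atTop)
    (heta : Tendsto (fun i => s i / N i * eta i) atTop (𝓝 η))
    (hu₀ : IsArgmin (pinned (active βs) 0) (penalizedQuad C (τ • w) (active βs) fun j =>
      limitPenalty (βs j) (l / |βs j| ^ γ₁) (η * |βs j| ^ γ₂) (τ * (√r₀ * z j))) u₀) :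
    Tendsto (fun i => s i • (βh i - βs)) atTop (𝓝 u₀) := by
  have hinactive {j : Fin p} (hj : j ∉ active βs) : βs j = 0 := by simpa [mem_active] using hj
  refine H.tendsto_smul_sub hs hτ (H.eventually_isWeightMinorant (E := active βs)
    (fun j hj => Or.inl (mem_active.1 hj)) fun j hj => hinactive hj)
    (fun j hj => ⟨hj, hinactive hj⟩) (fun j hj => ?_)
    (fun j _ => H.tendsto_transfer_weight heta j)
    (fun j hj => ?_) (fun j hj => (if_pos (hinactive hj)).symm) hu₀
  · simp only [minorantWeight_of_mem hj]
    exact H.tendsto_lasso_weight hlam (mem_active.1 hj)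
  · have hlasso := hlam_inactive.atTop_div_const (r := (‖z‖ + 1) ^ γ₁) (by positivity)
    simp only [pinSlope, hinactive hj, if_true, minorantWeight_of_notMem hj, div_div_eq_mul_div,
      ← mul_div_assoc, ← mul_assoc, sub_eq_add_neg]
    simpa only [mul_assoc] using hlasso.atTop_add (H.tendsto_transfer_weight heta j).neg

end Regimes

section Dominated

variable {E : Finset (Fin p)} {s : ℕ → ℝ} {ρ : ℝ} {a : ℕ → Fin p → ℝ} {cs : ℕ → Coef p}

theorem exists_eventually_sum_sub_le (hs : ∀ᶠ i in atTop, 0 < s i)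
    (hρ : Tendsto (fun i => √(N i : ℝ) / s i) atTop (𝓝 ρ))
    (ha : ∀ᶠ i in atTop, IsWeightMinorant (lam i) γ₁ (βt i) E (a i)) {c : Coef p}
    (hcs : Tendsto cs atTop (𝓝 c)) (hE : ∀ᶠ i in atTop, ∀ j ∉ E, s i * βs j + cs i j = 0) :
    ∃ K, ∀ᶠ i in atTop,
      ∑ j, (rescaledPenalty (N i) (s i) (eta i) γ₂ (a i) βs (βt i) j ((s i • (βh i - βs)) j)
        - rescaledPenalty (N i) (s i) (eta i) γ₂ (a i) βs (βt i) j (cs i j)) ≤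
      K * (s i / √(N i : ℝ)) * ‖s i • (βh i - βs) - cs i‖ := by
  have hbound : Tendsto (fun i => 2 * (‖Matrix.toEuclideanCLM (𝕜 := ℝ) (gram (X i))‖ * ‖cs i‖
        * (√(N i : ℝ) / s i) + ‖score (X i) (e i)‖)) atTop
      (𝓝 (2 * (‖Matrix.toEuclideanCLM (𝕜 := ℝ) C‖ * ‖c‖ * ρ + ‖w‖))) :=
    (((((continuous_toEuclideanCLM.tendsto C).comp H.tendsto_gram).norm.mul hcs.norm).mul hρ).add
      H.tendsto_score.norm).const_mul 2
  obtain ⟨K, hK⟩ := exists_gt (2 * (‖Matrix.toEuclideanCLM (𝕜 := ℝ) C‖ * ‖c‖ * ρ + ‖w‖))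
  refine ⟨K, ?_⟩
  filter_upwards [hs, ha, hE, hbound.eventually_le_const hK,
    H.tendsto_sqrt_size.eventually_gt_atTop 0] with i hs ha hE hbound hN
  have hgram : 0 ≤ quad (gram (X i)) (s i • (βh i - βs) - cs i) := by
    rw [quad_gram]
    positivity
  refine (sum_sub_le_of_penalizedQuad_le hgram
    ((H.isEstimate i).penalizedQuad_le hs (H.eta_nonneg i) ha hE)).trans ?_
  refine mul_le_mul_of_nonneg_right (le_trans (le_of_eq ?_)
    (mul_le_mul_of_nonneg_right hbound (by positivity))) (norm_nonneg _)
  rw [norm_smul, Real.norm_of_nonneg (by positivity)]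
  field_simp

theorem tendsto_smul_sub_of_dominated (hs : ∀ᶠ i in atTop, 0 < s i)
    (hρ : Tendsto (fun i => √(N i : ℝ) / s i) atTop (𝓝 ρ))
    (ha : ∀ᶠ i in atTop, IsWeightMinorant (lam i) γ₁ (βt i) E (a i)) {c : Coef p}
    (hcs : Tendsto cs atTop (𝓝 c)) (hE : ∀ᶠ i in atTop, ∀ j ∉ E, s i * βs j + cs i j = 0)
    {α : ℕ → Fin p → ℝ} {μ : ℕ → ℝ}
    (hα : ∀ j, Tendsto (fun i => α i j * (√(N i : ℝ) / s i)) atTop atTop)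
    (hμ : ∀ j, Tendsto (fun i => μ i / α i j) atTop (𝓝 0))
    (hpenalty : ∀ᶠ i in atTop, ∀ j x, α i j * |x - cs i j| ≤
      rescaledPenalty (N i) (s i) (eta i) γ₂ (a i) βs (βt i) j x
        - rescaledPenalty (N i) (s i) (eta i) γ₂ (a i) βs (βt i) j (cs i j) + μ i) :
    Tendsto (fun i => s i • (βh i - βs)) atTop (𝓝 c) := by
  obtain ⟨K, hK⟩ := H.exists_eventually_sum_sub_le hs hρ ha hcs hE
  have hslope : ∀ᶠ i in atTop, ∀ j, 2 * |K| + 1 ≤ α i j * (√(N i : ℝ) / s i) :=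
    eventually_all.2 fun j => (hα j).eventually_ge_atTop _
  have hdist : ∀ᶠ i in atTop, ∀ j,
      |(s i • (βh i - βs) - cs i) j| ≤ 2 * p * (μ i / α i j) := by
    filter_upwards [hs, hK, hslope, hpenalty, H.tendsto_sqrt_size.eventually_gt_atTop 0]
      with i hs hK hslope hpenalty hN j
    have hrate : 0 < s i / √(N i : ℝ) := by positivity
    rw [mul_assoc, ← mul_div_assoc]
    refine abs_apply_le_of_sum_mul_abs_le (K := |K| * (s i / √(N i : ℝ))) (by positivity)
      (fun k => ?_) ?_ j
    · have hinv : α i k * (√(N i : ℝ) / s i) * (s i / √(N i : ℝ)) = α i k := by field_simp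
      linarith [mul_le_mul_of_nonneg_right (hslope k) hrate.le]
    · refine (Finset.sum_le_sum fun k _ => hpenalty k _).trans ?_
      rw [Finset.sum_add_distrib, Finset.sum_const, Finset.card_univ, Fintype.card_fin,
        nsmul_eq_mul]
      refine add_le_add_left (hK.trans ?_) _
      gcongr
      exact le_abs_self K
  have hdiff : Tendsto (fun i => s i • (βh i - βs) - cs i) atTop (𝓝 0) := by
    refine squeeze_zero_norm' (hdist.mono fun i hi =>
      (norm_le_sum_abs _).trans (Finset.sum_le_sum fun j _ => hi j)) ?_
    simpa using tendsto_finsetSum Finset.univ fun j _ => (hμ j).const_mul (2 * (p : ℝ))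
  simpa using hdiff.add hcs

end Dominated

section SourceScale

theorem tendsto_sqrt_size_div_sqrt_source :
    Tendsto (fun i => √(N i : ℝ) / √(m i : ℝ)) atTop (𝓝 √r₀) :=
  H.tendsto_ratio.sqrt.congr fun _ => Real.sqrt_div (Nat.cast_nonneg _) _

theorem eventually_sqrt_source_pos : ∀ᶠ i in atTop, 0 < √(m i : ℝ) :=
  H.source_pos.mono fun _ hi => by positivity

theorem eventually_sqrt_source_rpow_add : ∀ᶠ i in atTop,
    √((m i : ℝ) ^ (γ₁ + γ₂)) = √((m i : ℝ) ^ γ₁) * √((m i : ℝ) ^ γ₂) := by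
  filter_upwards [H.source_pos] with i hi
  rw [Real.rpow_add (Nat.cast_pos.2 hi), Real.sqrt_mul (by positivity)]

theorem tendsto_pinSlope_atTop_of_ne_zero {a : ℕ → Fin p → ℝ} (hj : βs j ≠ 0)
    (ha : ∀ i, a i j = lam i / |βt i j| ^ γ₁)
    (heta : Tendsto (fun i => eta i / √(N i : ℝ)) atTop atTop)
    (hratio : Tendsto (fun i => eta i / lam i) atTop atTop) :
    Tendsto (fun i => pinSlope (N i) √(m i : ℝ) (eta i) γ₂ (a i) βs (βt i) j
      * (√(N i : ℝ) / √(m i : ℝ))) atTop atTop := by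
  have hpos {γ : ℝ} : 0 < |βs j| ^ γ := abs_rpow_pos (Or.inl hj)
  have hexcess : Tendsto (fun i => |βt i j| ^ γ₂ - (eta i / lam i)⁻¹ / |βt i j| ^ γ₁) atTop
      (𝓝 (|βs j| ^ γ₂ - 0 / |βs j| ^ γ₁)) :=
    (H.tendsto_abs_initial_rpow H.gamma₂_nonneg j).sub
      (hratio.inv_tendsto_atTop.div (H.tendsto_abs_initial_rpow H.gamma₁_nonneg j) hpos.ne')
  rw [zero_div, sub_zero] at hexcess
  refine (heta.atTop_mul_pos hpos hexcess).congr' ?_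
  filter_upwards [heta.eventually_gt_atTop 0, H.tendsto_sqrt_size.eventually_gt_atTop 0,
    H.eventually_sqrt_source_pos] with i heta hN hm
  have heta_ne : eta i ≠ 0 := fun h => by simp [h] at heta
  rw [pinSlope, if_neg hj, ha]
  nth_rw 2 3 [← Real.mul_self_sqrt (Nat.cast_nonneg (N i))]
  field_simp

theorem tendsto_pinSlope_atTop_of_eq_zero {a : ℕ → Fin p → ℝ} {M : ℝ} (hj : βs j = 0) (hM : 0 < M)
    (ha : ∀ i, a i j = lam i / (M / √((m i : ℝ) ^ γ₁)))
    (hlam : Tendsto (fun i => √((m i : ℝ) ^ γ₁ / N i) * lam i) atTop atTop)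
    (hratio : Tendsto (fun i => eta i / (√((m i : ℝ) ^ (γ₁ + γ₂)) * lam i)) atTop (𝓝 0)) :
    Tendsto (fun i => pinSlope (N i) √(m i : ℝ) (eta i) γ₂ (a i) βs (βt i) j
      * (√(N i : ℝ) / √(m i : ℝ))) atTop atTop := by
  have hexcess := (hratio.mul (H.tendsto_abs_scaled_rpow H.gamma₂_nonneg j)).const_sub (1 / M)
  rw [zero_mul, sub_zero] at hexcess
  refine (hlam.atTop_mul_pos (one_div_pos.2 hM) hexcess).congr' ?_
  filter_upwards [hlam.eventually_gt_atTop 0, H.tendsto_sqrt_size.eventually_gt_atTop 0,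
    H.eventually_abs_initial_rpow_eq γ₂ hj, H.eventually_sqrt_source_rpow_add, H.source_pos]
    with i hlam hN hscaled hadd hsource
  have hlam_ne : lam i ≠ 0 := fun h => by simp [h] at hlam
  rw [pinSlope, if_pos hj, ha, hscaled, hadd, Real.sqrt_div (by positivity)]
  nth_rw 2 3 [← Real.mul_self_sqrt (Nat.cast_nonneg (N i))]
  have hroot {γ : ℝ} : 0 < √((m i : ℝ) ^ γ) := by positivity
  have hroot₁ := (hroot (γ := γ₁)).ne'
  have hroot₂ := (hroot (γ := γ₂)).ne'
  field_simp

theorem tendsto_sqrt_source_smul_sub_of_pinned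
    (hlam : Tendsto (fun i => √((m i : ℝ) ^ γ₁ / N i) * lam i) atTop atTop)
    (heta : Tendsto (fun i => eta i / √(N i : ℝ)) atTop atTop)
    (hratio : Tendsto (fun i => eta i / lam i) atTop atTop)
    (hratio_source : Tendsto (fun i => eta i / (√((m i : ℝ) ^ (γ₁ + γ₂)) * lam i)) atTop (𝓝 0)) :
    Tendsto (fun i => √(m i : ℝ) • (βh i - βs)) atTop
      (𝓝 (WithLp.toLp 2 fun j => if βs j = 0 then 0 else z j)) := by
  have hmem {j : Fin p} : j ∉ active βs ↔ βs j = 0 := by simp [mem_active]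
  have hminorant := H.eventually_isWeightMinorant (E := active βs)
    (fun j hj => Or.inl (mem_active.1 hj)) fun j hj => hmem.1 hj
  refine H.tendsto_smul_sub_of_dominated H.eventually_sqrt_source_pos
    H.tendsto_sqrt_size_div_sqrt_source hminorant (μ := fun _ => 0)
    (α := fun i => pinSlope (N i) √(m i : ℝ) (eta i) γ₂ (minorantWeight (active βs) (lam i) γ₁
      ((‖z‖ + 1) ^ γ₁ / √((m i : ℝ) ^ γ₁)) (βt i)) βs (βt i))
    (cs := fun i => WithLp.toLp 2 (pinPoint √(m i : ℝ) βs (βt i)))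
    (((PiLp.continuous_toLp 2 fun _ : Fin p => ℝ).tendsto _).comp
      (tendsto_pi_nhds.2 fun j => tendsto_pinPoint (H.tendsto_initial_apply j)))
    (Eventually.of_forall fun i j hj => by simp [pinPoint, hmem.1 hj]) (fun j => ?_)
    (fun j => by simp) (hminorant.mono fun i hi j x => ?_)
  · by_cases hj : βs j = 0
    · exact H.tendsto_pinSlope_atTop_of_eq_zero hj (by positivity)
        (fun i => minorantWeight_of_notMem (hmem.2 hj)) hlam hratio_source
    · exact H.tendsto_pinSlope_atTop_of_ne_zero hj
        (fun i => minorantWeight_of_mem (mem_active.2 hj)) heta hratio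
  · rw [add_zero]
    exact pinSlope_mul_le (Real.sqrt_nonneg _) (H.eta_nonneg i) hi.nonneg j x

theorem exists_mul_le_transfer_sub_lasso_of_eq_zero (hj : βs j = 0) (hγ₁ : z j ≠ 0 ∨ γ₁ = 0)
    (hγ₂ : z j ≠ 0 ∨ γ₂ = 0) (heta : ∀ᶠ i in atTop, 0 < eta i)
    (hlam : Tendsto (fun i => √((m i : ℝ) ^ (γ₁ + γ₂)) * lam i / eta i) atTop (𝓝 0)) :
    ∃ κ > 0, ∀ᶠ i in atTop, κ * (eta i / √((m i : ℝ) ^ γ₂)) ≤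
      eta i * |βt i j| ^ γ₂ - lam i / |βt i j| ^ γ₁ := by
  have hexcess := (H.tendsto_abs_scaled_rpow H.gamma₂_nonneg j).sub
    (hlam.div (H.tendsto_abs_scaled_rpow H.gamma₁_nonneg j) (abs_rpow_pos hγ₁).ne')
  rw [zero_div, sub_zero] at hexcess
  refine ⟨|z j| ^ γ₂ / 2, half_pos (abs_rpow_pos hγ₂), ?_⟩
  filter_upwards [hexcess.eventually_const_le (half_lt_self (abs_rpow_pos hγ₂)), heta,
    H.source_pos, H.eventually_abs_initial_rpow_eq γ₁ hj, H.eventually_abs_initial_rpow_eq γ₂ hj,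
    H.eventually_sqrt_source_rpow_add] with i hle heta hm hscaled₁ hscaled₂ hadd
  have hroot : √((m i : ℝ) ^ γ₂) ≠ 0 := by positivity
  refine (mul_le_mul_of_nonneg_right hle (by positivity)).trans_eq ?_
  rw [Pi.div_apply, hscaled₁, hscaled₂, hadd, div_div_eq_mul_div]
  field_simp

theorem exists_mul_le_transfer_sub_lasso_of_ne_zero (hj : βs j ≠ 0)
    (heta : ∀ᶠ i in atTop, 0 < eta i)
    (hlam : Tendsto (fun i => √((m i : ℝ) ^ (γ₁ + γ₂)) * lam i / eta i) atTop (𝓝 0)) :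
    ∃ κ > 0, ∀ᶠ i in atTop, κ * (eta i / √((m i : ℝ) ^ γ₂)) ≤
      eta i * |βt i j| ^ γ₂ - lam i / |βt i j| ^ γ₁ := by
  have hratio_nonneg (i : ℕ) : 0 ≤ lam i / eta i := div_nonneg (H.lam_nonneg i) (H.eta_nonneg i)
  have hratio : Tendsto (fun i => lam i / eta i) atTop (𝓝 0) := by
    refine squeeze_zero' (Eventually.of_forall hratio_nonneg) ?_ hlam
    filter_upwards [H.eventually_one_le_sqrt_source_rpow
      (add_nonneg H.gamma₁_nonneg H.gamma₂_nonneg)] with i hi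
    rw [mul_div_assoc]
    exact le_mul_of_one_le_left (hratio_nonneg i) hi
  have hpos {γ : ℝ} : 0 < |βs j| ^ γ := abs_rpow_pos (Or.inl hj)
  have hexcess := (H.tendsto_abs_initial_rpow H.gamma₂_nonneg j).sub
    (hratio.div (H.tendsto_abs_initial_rpow H.gamma₁_nonneg j) hpos.ne')
  rw [zero_div, sub_zero] at hexcess
  refine ⟨|βs j| ^ γ₂ / 2, half_pos hpos, ?_⟩
  filter_upwards [hexcess.eventually_const_le (half_lt_self hpos), heta,
    H.eventually_one_le_sqrt_source_rpow H.gamma₂_nonneg] with i hle heta hroot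
  refine (mul_le_mul hle (div_le_self heta.le hroot) (by positivity)
    ((half_pos hpos).le.trans hle)).trans_eq ?_
  rw [Pi.div_apply]
  field_simp

theorem exists_transfer_gap {E : Finset (Fin p)} (hE : ∀ j, j ∈ E ↔ βs j ≠ 0 ∨ z j ≠ 0 ∨ γ₁ = 0)
    (hz : ∀ j, βs j = 0 → z j ≠ 0 ∨ γ₂ = 0) (heta : ∀ᶠ i in atTop, 0 < eta i)
    (hlam : Tendsto (fun i => √((m i : ℝ) ^ (γ₁ + γ₂)) * lam i / eta i) atTop (𝓝 0)) :
    ∃ κ : Fin p → ℝ, (∀ j, 0 < κ j) ∧ (∀ j ∉ E, κ j = 1) ∧ ∀ᶠ i in atTop, ∀ j ∈ E,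
      κ j * (eta i / √((m i : ℝ) ^ γ₂)) ≤ eta i * |βt i j| ^ γ₂ - lam i / |βt i j| ^ γ₁ := by
  have hgap (j : Fin p) (hj : j ∈ E) : ∃ κ > 0, ∀ᶠ i in atTop,
      κ * (eta i / √((m i : ℝ) ^ γ₂)) ≤ eta i * |βt i j| ^ γ₂ - lam i / |βt i j| ^ γ₁ := by
    by_cases hβ : βs j = 0
    · exact H.exists_mul_le_transfer_sub_lasso_of_eq_zero hβ
        (((hE j).1 hj).resolve_left (not_not.2 hβ)) (hz j hβ) heta hlam
    · exact H.exists_mul_le_transfer_sub_lasso_of_ne_zero hβ heta hlam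
  choose! κ hκ hle using hgap
  refine ⟨fun j => if j ∈ E then κ j else 1, fun j => ?_, fun j hj => if_neg hj,
    (Finset.eventually_all E).2 fun j hj => by simpa only [if_pos hj] using hle j hj⟩
  by_cases hj : j ∈ E
  · simpa only [if_pos hj] using hκ j hj
  · simp only [if_neg hj, one_pos]

theorem tendsto_transferPoint {E : Finset (Fin p)} (hE : ∀ j ∉ E, z j = 0) :
    Tendsto (fun i => transferPoint E √(m i : ℝ) βs (βt i)) atTop (𝓝 z) := by
  refine ((PiLp.continuous_toLp 2 fun _ : Fin p => ℝ).tendsto _).comp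
    (tendsto_pi_nhds.2 fun j => ?_)
  by_cases hj : j ∈ E
  · simpa only [if_pos hj] using H.tendsto_initial_apply j
  · simpa only [if_neg hj, hE j hj] using tendsto_const_nhds

theorem tendsto_transferSlack {E : Finset (Fin p)} (hE : ∀ j ∉ E, z j = 0) :
    Tendsto (fun i => transferSlack E √(m i : ℝ) βs (βt i)) atTop (𝓝 0) := by
  rw [← Finset.sum_const_zero (M := ℝ) (s := Eᶜ)]
  refine tendsto_finsetSum _ fun j hj => ?_
  have hlim := (H.tendsto_initial_apply j).abs.const_mul 2
  rwa [hE j (Finset.mem_compl.1 hj), abs_zero, mul_zero] at hlim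

theorem tendsto_transfer_rate
    (heta : Tendsto (fun i => eta i / √(N i * (m i : ℝ) ^ γ₂)) atTop atTop) :
    Tendsto (fun i => √(m i : ℝ) / N i * (eta i / √((m i : ℝ) ^ γ₂)) * (√(N i : ℝ) / √(m i : ℝ)))
      atTop atTop := by
  refine heta.congr' ?_
  filter_upwards [H.tendsto_sqrt_size.eventually_gt_atTop 0, H.eventually_sqrt_source_pos]
    with i hN hm
  rw [Real.sqrt_mul (Nat.cast_nonneg _)]
  nth_rw 2 [← Real.mul_self_sqrt (Nat.cast_nonneg (N i))]
  field_simp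

theorem tendsto_sqrt_source_smul_sub_of_transfer
    (hz : ∀ j, βs j = 0 → z j ≠ 0 ∨ γ₂ = 0)
    (heta : Tendsto (fun i => eta i / √(N i * (m i : ℝ) ^ γ₂)) atTop atTop)
    (hlam : Tendsto (fun i => √((m i : ℝ) ^ (γ₁ + γ₂)) * lam i / eta i) atTop (𝓝 0)) :
    Tendsto (fun i => √(m i : ℝ) • (βh i - βs)) atTop (𝓝 z) := by
  let E : Finset (Fin p) := {j | βs j ≠ 0 ∨ z j ≠ 0 ∨ γ₁ = 0}
  have hE (j : Fin p) : j ∈ E ↔ βs j ≠ 0 ∨ z j ≠ 0 ∨ γ₁ = 0 := by simp [E]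
  have hEc (j : Fin p) (hj : j ∉ E) : βs j = 0 ∧ z j = 0 ∧ γ₂ = 0 := by
    rw [hE] at hj
    push Not at hj
    exact ⟨hj.1, hj.2.1, (hz j hj.1).resolve_left (not_not.2 hj.2.1)⟩
  have heta_pos : ∀ᶠ i in atTop, 0 < eta i := by
    filter_upwards [heta.eventually_gt_atTop 0] with i hi
    exact (H.eta_nonneg i).lt_of_ne fun h => by simp [← h] at hi
  obtain ⟨κ, hκ, hκ_one, hgap⟩ := H.exists_transfer_gap hE hz heta_pos hlam
  let ν (i : ℕ) : ℝ := √(m i : ℝ) / N i * (eta i / √((m i : ℝ) ^ γ₂))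
  have hν := H.tendsto_transfer_rate heta
  have hminorant := H.eventually_isWeightMinorant (fun j => (hE j).1) fun j hj => (hEc j hj).1
  refine H.tendsto_smul_sub_of_dominated H.eventually_sqrt_source_pos
    H.tendsto_sqrt_size_div_sqrt_source hminorant (α := fun i j => κ j * ν i)
    (μ := fun i => ν i * transferSlack E √(m i : ℝ) βs (βt i))
    (H.tendsto_transferPoint fun j hj => (hEc j hj).2.1)
    (Eventually.of_forall fun i j hj => by simp [transferPoint, hj, (hEc j hj).1])
    (fun j => (hν.const_mul_atTop (hκ j)).congr fun i => (mul_assoc _ _ _).symm) (fun j => ?_) ?_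
  · have hlim := (H.tendsto_transferSlack fun j hj => (hEc j hj).2.1).div_const (κ j)
    rw [zero_div] at hlim
    refine hlim.congr' ?_
    filter_upwards [hν.eventually_gt_atTop 0] with i hi
    rw [mul_comm (κ j), mul_div_mul_left _ _ (left_ne_zero_of_mul hi.ne')]
  · filter_upwards [hgap, hminorant, heta_pos] with i hgap hminorant heta j x
    refine mul_abs_sub_transferPoint_le (Real.sqrt_nonneg _) heta.le (by positivity)
      hminorant.nonneg (fun k hk => ?_) (fun k hk => ?_) j x
    · rw [minorantWeight_of_mem hk]
      exact hgap k hk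
    · obtain ⟨hβ, -, hγ₂⟩ := hEc k hk
      exact ⟨hβ, hκ_one k hk, by simp [hγ₂]⟩

end SourceScale

variable {l η : ℝ} {u₀ : Coef p}

section SizeScale

theorem tendsto_sqrt_size_div_self :
    Tendsto (fun i => √(N i : ℝ) / √(N i : ℝ)) atTop (𝓝 1) :=
  tendsto_const_nhds.congr' ((H.tendsto_sqrt_size.eventually_ne_atTop 0).mono
    fun _ hi => (div_self hi).symm)

theorem tendsto_sqrt_size_smul_sub_of_free (hl : γ₁ = 0 → l = 0)
    (hz : ∀ j, βs j = 0 → z j ≠ 0 ∨ γ₁ = 0)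
    (hlam : Tendsto (fun i => √((m i : ℝ) ^ γ₁ / N i) * lam i) atTop (𝓝 l))
    (heta : Tendsto (fun i => eta i / √(N i : ℝ)) atTop (𝓝 η))
    (hu₀ : IsArgmin (pinned Finset.univ 0) (penalizedQuad C w Finset.univ fun j =>
      limitPenalty (βs j) (if βs j = 0 then l / |z j| ^ γ₁ else 0) (η * |βs j| ^ γ₂)
        (√r₀ * z j)) u₀) :
    Tendsto (fun i => √(N i : ℝ) • (βh i - βs)) atTop (𝓝 u₀) :=
  H.tendsto_smul_sub_of_free H.tendsto_sqrt_size H.tendsto_sqrt_size_div_self hl hz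
    (by simpa only [sqrt_div_self_mul_mul_sqrt _ (Real.rpow_nonneg (Nat.cast_nonneg _) _)]
      using hlam)
    (by simpa only [sqrt_div_self_mul] using heta) (by simpa only [one_smul, one_mul] using hu₀)

theorem tendsto_sqrt_size_smul_sub_of_active_pinned (hz : ∀ j, βs j = 0 → z j ≠ 0 ∨ γ₁ = 0)
    (hlam : Tendsto (fun i => √((m i : ℝ) ^ γ₁ / N i) * lam i) atTop (𝓝 l))
    (heta : Tendsto (fun i => eta i / √(N i : ℝ)) atTop atTop)
    (heta_inactive : Tendsto (fun i => eta i / √(N i * (m i : ℝ) ^ γ₂)) atTop (𝓝 η))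
    (hu₀ : IsArgmin (pinned (active βs)ᶜ (WithLp.toLp 2 fun j => √r₀ * z j))
      (penalizedQuad C w (active βs)ᶜ fun j =>
        limitPenalty (βs j) (l / |z j| ^ γ₁) (η * |z j| ^ γ₂) (√r₀ * z j)) u₀) :
    Tendsto (fun i => √(N i : ℝ) • (βh i - βs)) atTop (𝓝 u₀) :=
  H.tendsto_smul_sub_of_active_pinned H.tendsto_sqrt_size H.tendsto_sqrt_size_div_self hz
    (by simpa only [sqrt_div_self_mul_mul_sqrt _ (Real.rpow_nonneg (Nat.cast_nonneg _) _)]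
      using hlam)
    (by simpa only [sqrt_div_self_mul] using heta)
    (by simpa only [sqrt_div_self_mul, div_div, ← Real.sqrt_mul (Nat.cast_nonneg _)]
      using heta_inactive)
    (by simpa only [one_smul, one_mul] using hu₀)

theorem tendsto_sqrt_size_smul_sub_of_inactive_pinned
    (hlam_inactive : Tendsto (fun i => √((m i : ℝ) ^ γ₁ / N i) * lam i) atTop atTop)
    (hlam : Tendsto (fun i => lam i / √(N i : ℝ)) atTop (𝓝 l))
    (heta : Tendsto (fun i => eta i / √(N i : ℝ)) atTop (𝓝 η))
    (hu₀ : IsArgmin (pinned (active βs) 0) (penalizedQuad C w (active βs) fun j =>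
      limitPenalty (βs j) (l / |βs j| ^ γ₁) (η * |βs j| ^ γ₂) (√r₀ * z j)) u₀) :
    Tendsto (fun i => √(N i : ℝ) • (βh i - βs)) atTop (𝓝 u₀) :=
  H.tendsto_smul_sub_of_inactive_pinned H.tendsto_sqrt_size H.tendsto_sqrt_size_div_self
    (by simpa only [sqrt_div_self_mul] using hlam)
    (by simpa only [sqrt_div_self_mul_mul_sqrt _ (Real.rpow_nonneg (Nat.cast_nonneg _) _)]
      using hlam_inactive)
    (by simpa only [sqrt_div_self_mul] using heta) (by simpa only [one_smul, one_mul] using hu₀)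

end SizeScale

theorem tendsto_size_div_smul_sub_of_inactive_pinned (hγ₁ : 0 < γ₁)
    (hlam : Tendsto (fun i => lam i / √(N i : ℝ)) atTop atTop)
    (hlam_zero : Tendsto (fun i => lam i / N i) atTop (𝓝 0))
    (heta : Tendsto (fun i => eta i / lam i) atTop (𝓝 0))
    (hu₀ : IsArgmin (pinned (active βs) 0) (penalizedQuad C 0 (active βs) fun j =>
      limitPenalty (βs j) (1 / |βs j| ^ γ₁) 0 0) u₀) :
    Tendsto (fun i => ((N i : ℝ) / lam i) • (βh i - βs)) atTop (𝓝 u₀) := by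
  have hpos : ∀ᶠ i in atTop, 0 < (N i : ℝ) ∧ 0 < lam i := by
    filter_upwards [H.tendsto_size.eventually_gt_atTop 0, hlam.eventually_gt_atTop 0] with i hN hi
    exact ⟨Nat.cast_pos.2 hN, (H.lam_nonneg i).lt_of_ne fun h => by simp [← h] at hi⟩
  have hs : Tendsto (fun i => (N i : ℝ) / lam i) atTop atTop := by
    have hright : Tendsto (fun i => lam i / N i) atTop (𝓝[>] 0) :=
      tendsto_nhdsWithin_iff.2 ⟨hlam_zero, hpos.mono fun i hi => div_pos hi.2 hi.1⟩
    simpa only [Pi.inv_def, inv_div] using hright.inv_tendsto_nhdsGT_zero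
  have hτ : Tendsto (fun i => (N i : ℝ) / lam i / √(N i : ℝ)) atTop (𝓝 0) :=
    hlam.inv_tendsto_atTop.congr fun i => by
      rw [Pi.inv_apply, inv_div, div_right_comm, Real.div_sqrt]
  have hone : ∀ᶠ i in atTop, (N i : ℝ) / lam i / N i * lam i = 1 := by
    filter_upwards [hpos] with i ⟨hN, hl⟩
    field_simp
  have hetas : Tendsto (fun i => (N i : ℝ) / lam i / N i * eta i) atTop (𝓝 0) := by
    refine heta.congr' ?_
    filter_upwards [hpos] with i ⟨hN, hl⟩
    field_simp
  exact H.tendsto_smul_sub_of_inactive_pinned hs hτ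
    (tendsto_const_nhds.congr' (hone.mono fun _ hi => hi.symm))
    ((H.tendsto_sqrt_source_rpow hγ₁).congr' (hone.mono fun _ hi => by
      simp only [hi, one_mul])) hetas
    (by simpa only [zero_smul, zero_mul] using hu₀)

end IsEstimateSeq

theorem ae_forall_ne_zero_or {Ω' : Type*} [MeasurableSpace Ω'] {P' : Measure Ω'} {p : ℕ}
    {βs : Coef p} {z : Ω' → Coef p} {γ : ℝ} (hγ : 0 ≤ γ)
    (h : 0 < γ → ∀ j ∉ active βs, ∀ᵐ ω ∂P', z ω j ≠ 0) :
    ∀ᵐ ω ∂P', ∀ j, βs j = 0 → z ω j ≠ 0 ∨ γ = 0 := by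
  obtain rfl | hγ := hγ.eq_or_lt
  · exact Eventually.of_forall fun _ _ _ => Or.inr rfl
  · refine ae_all_iff.2 fun j => ?_
    by_cases hj : βs j = 0
    · exact (h hγ j (by simp [mem_active, hj])).mono fun _ hω _ => Or.inl hω
    · exact Eventually.of_forall fun _ h0 => absurd h0 hj

/-- Adaptive transfer lasso estimates `βh n` with initial estimates `βt n` from samples of size
`m n`, in the asymptotic regime of the theorem.  The noise `ε` and the initial estimates enter only
through the joint limit `(z, W)` in distribution of the scaled initial error and the score. -/
structure IsEstimateModel {Ω Ω' : Type*} [MeasurableSpace Ω] [MeasurableSpace Ω']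
    (P : Measure Ω) [IsProbabilityMeasure P] (P' : Measure Ω') [IsProbabilityMeasure P']
    {p : ℕ} (βs : Coef p) (γ₁ γ₂ r₀ : ℝ) (C : Matrix (Fin p) (Fin p) ℝ) (z W : Ω' → Coef p)
    (m : ℕ → ℕ) (X : (n : ℕ) → Matrix (Fin n) (Fin p) ℝ) (ε : (n : ℕ) → Fin n → Ω → ℝ)
    (lam eta : ℕ → ℝ) (βt βh : ℕ → Ω → Coef p) : Prop where
  posDef : C.PosDef
  gamma₁_nonneg : 0 ≤ γ₁
  gamma₂_nonneg : 0 ≤ γ₂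
  source_pos : ∀ᶠ n in atTop, 0 < m n
  tendsto_ratio : Tendsto (fun n : ℕ => (n : ℝ) / m n) atTop (𝓝 r₀)
  tendsto_gram : Tendsto (fun n => gram (X n)) atTop (𝓝 C)
  tendstoInDistribution_initial_score : TendstoInDistribution
    (fun n ω => (√(m n : ℝ) • (βt n ω - βs), score (X n) fun i => ε n i ω)) atTop
    (fun ω => (z ω, W ω)) (fun _ => P) P'
  lam_nonneg : ∀ n, 0 ≤ lam n
  eta_nonneg : ∀ n, 0 ≤ eta n
  aemeasurable_estimate : ∀ n, AEMeasurable (βh n) P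
  isEstimate : ∀ n, ∀ᵐ ω ∂P, IsEstimate (X n) (response (X n) βs fun i => ε n i ω) (βt n ω)
    (lam n) (eta n) γ₁ γ₂ (βh n ω)

namespace IsEstimateModel

variable {Ω Ω' : Type*} [MeasurableSpace Ω] [MeasurableSpace Ω']
  {P : Measure Ω} [IsProbabilityMeasure P] {P' : Measure Ω'} [IsProbabilityMeasure P']
  {p : ℕ} {βs : Coef p} {γ₁ γ₂ r₀ : ℝ} {C : Matrix (Fin p) (Fin p) ℝ} {z W : Ω' → Coef p}
  {m : ℕ → ℕ} {X : (n : ℕ) → Matrix (Fin n) (Fin p) ℝ} {ε : (n : ℕ) → Fin n → Ω → ℝ}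
  {lam eta : ℕ → ℝ} {βt βh : ℕ → Ω → Coef p} {l η : ℝ}
  (M : IsEstimateModel P P' βs γ₁ γ₂ r₀ C z W m X ε lam eta βt βh)

include M

theorem aemeasurable_initial_limit : AEMeasurable z P' :=
  M.tendstoInDistribution_initial_score.aemeasurable_limit.fst

theorem aemeasurable_score_limit : AEMeasurable W P' :=
  M.tendstoInDistribution_initial_score.aemeasurable_limit.snd

theorem tendstoInDistribution_of_forall_realization (s : ℕ → ℝ) {G : Ω' → Coef p}
    (hG : AEMeasurable G P')
    (h : ∀ᵐ ω ∂P', ∀ (k : ℕ → ℕ) (e : (i : ℕ) → Fin (k i) → ℝ) (bt bh : ℕ → Coef p),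
      IsEstimateSeq βs γ₁ γ₂ r₀ C (z ω) (W ω) k (m ∘ k) (fun i => X (k i)) e (lam ∘ k) (eta ∘ k)
        bt bh → Tendsto (fun i => s (k i) • (bh i - βs)) atTop (𝓝 (G ω))) :
    TendstoInDistribution (fun n ω => s n • (βh n ω - βs)) atTop G (fun _ => P) P' := by
  refine tendstoInDistribution_of_forall_seq
    (fun n x y => ∃ (e : Fin n → ℝ) (bt bh : Coef p),
      IsEstimate (X n) (response (X n) βs e) bt (lam n) (eta n) γ₁ γ₂ bh ∧
      x = (√(m n : ℝ) • (bt - βs), score (X n) e) ∧ y = s n • (bh - βs))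
    M.tendstoInDistribution_initial_score
    (fun n => ((M.aemeasurable_estimate n).sub_const βs).const_smul (s n)) hG (fun n => ?_) ?_
  · filter_upwards [M.isEstimate n] with ω hω
    exact ⟨fun i => ε n i ω, βt n ω, βh n ω, hω, rfl, rfl⟩
  · filter_upwards [h] with ω hω k x y hk hx hR
    choose e bt bh hest hxe hy using hR
    obtain rfl := funext hxe
    obtain rfl := funext hy
    exact hω k e bt bh
      { posDef := M.posDef
        gamma₁_nonneg := M.gamma₁_nonneg
        gamma₂_nonneg := M.gamma₂_nonneg
        tendsto_size := hk
        source_pos := hk.eventually M.source_pos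
        tendsto_ratio := M.tendsto_ratio.comp hk
        tendsto_gram := M.tendsto_gram.comp hk
        tendsto_score := hx.snd_nhds
        tendsto_initial := hx.fst_nhds
        lam_nonneg := fun i => M.lam_nonneg (k i)
        eta_nonneg := fun i => M.eta_nonneg (k i)
        isEstimate := hest }

theorem exists_isArgmin_tendstoInDistribution (s : ℕ → ℝ) (T : Finset (Fin p))
    {A B d : Ω' → Fin p → ℝ} {w c : Ω' → Coef p} (hA : AEMeasurable A P')
    (hB : AEMeasurable B P') (hd : AEMeasurable d P') (hw : AEMeasurable w P')
    (hc : AEMeasurable c P') (hA0 : ∀ ω, 0 ≤ A ω) (hB0 : ∀ ω, 0 ≤ B ω)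
    (h : ∀ᵐ ω ∂P', ∀ (k : ℕ → ℕ) (e : (i : ℕ) → Fin (k i) → ℝ) (bt bh : ℕ → Coef p) (u : Coef p),
      IsEstimateSeq βs γ₁ γ₂ r₀ C (z ω) (W ω) k (m ∘ k) (fun i => X (k i)) e (lam ∘ k) (eta ∘ k)
        bt bh →
      IsArgmin (pinned T (c ω)) (penalizedQuad C (w ω) T fun j =>
        limitPenalty (βs j) (A ω j) (B ω j) (d ω j)) u →
      Tendsto (fun i => s (k i) • (bh i - βs)) atTop (𝓝 u)) :
    ∃ uh : Ω' → Coef p,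
      (∀ ω, IsArgmin (pinned T (c ω)) (penalizedQuad C (w ω) T fun j =>
        limitPenalty (βs j) (A ω j) (B ω j) (d ω j)) (uh ω)) ∧
      TendstoInDistribution (fun n ω => s n • (βh n ω - βs)) atTop uh (fun _ => P) P' := by
  obtain ⟨uh, huh, hmin⟩ := exists_aemeasurable_isArgmin M.posDef T βs hA hB hd hw hc hA0 hB0
  refine ⟨uh, hmin, M.tendstoInDistribution_of_forall_realization s huh ?_⟩
  filter_upwards [h] with ω hω k e bt bh H
  exact hω k e bt bh (uh ω) H (hmin ω)

theorem tendstoInDistribution_sqrt_source_smul_sub_of_transfer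
    (hz : 0 < γ₂ → ∀ j ∉ active βs, ∀ᵐ ω ∂P', z ω j ≠ 0)
    (heta : Tendsto (fun n : ℕ => eta n / √(n * (m n : ℝ) ^ γ₂)) atTop atTop)
    (hlam : Tendsto (fun n : ℕ => √((m n : ℝ) ^ (γ₁ + γ₂)) * lam n / eta n) atTop (𝓝 0)) :
    TendstoInDistribution (fun n ω => √(m n : ℝ) • (βh n ω - βs)) atTop z (fun _ => P) P' := by
  refine M.tendstoInDistribution_of_forall_realization (fun n => √(m n : ℝ))
    M.aemeasurable_initial_limit ?_
  filter_upwards [ae_forall_ne_zero_or M.gamma₂_nonneg hz] with ω hω k e bt bh H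
  exact H.tendsto_sqrt_source_smul_sub_of_transfer hω (heta.comp H.tendsto_size)
    (hlam.comp H.tendsto_size)

theorem tendstoInDistribution_sqrt_source_smul_sub_of_pinned
    (hlam : Tendsto (fun n : ℕ => √((m n : ℝ) ^ γ₁ / n) * lam n) atTop atTop)
    (heta : Tendsto (fun n : ℕ => eta n / √(n : ℝ)) atTop atTop)
    (hratio : Tendsto (fun n : ℕ => eta n / lam n) atTop atTop)
    (hratio_source : Tendsto (fun n : ℕ => eta n / (√((m n : ℝ) ^ (γ₁ + γ₂)) * lam n))
      atTop (𝓝 0)) :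
    TendstoInDistribution (fun n ω => √(m n : ℝ) • (βh n ω - βs)) atTop
      (fun ω => WithLp.toLp 2 fun j => if βs j = 0 then 0 else z ω j) (fun _ => P) P' := by
  have hpin : Measurable fun x : Coef p =>
      (WithLp.toLp 2 fun j => if βs j = 0 then 0 else x j : Coef p) := by
    refine (WithLp.measurable_toLp 2 _).comp (measurable_pi_lambda _ fun j => ?_)
    split_ifs <;> fun_prop
  refine M.tendstoInDistribution_of_forall_realization (fun n => √(m n : ℝ))
    (hpin.comp_aemeasurable M.aemeasurable_initial_limit) ?_
  refine Eventually.of_forall fun ω k e bt bh H => ?_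
  exact H.tendsto_sqrt_source_smul_sub_of_pinned (hlam.comp H.tendsto_size)
    (heta.comp H.tendsto_size) (hratio.comp H.tendsto_size) (hratio_source.comp H.tendsto_size)

theorem tendstoInDistribution_sqrt_size_smul_sub_of_free (hl : γ₁ = 0 → l = 0)
    (hz : 0 < γ₁ → ∀ j ∉ active βs, ∀ᵐ ω ∂P', z ω j ≠ 0)
    (hlam : Tendsto (fun n : ℕ => √((m n : ℝ) ^ γ₁ / n) * lam n) atTop (𝓝 l))
    (heta : Tendsto (fun n : ℕ => eta n / √(n : ℝ)) atTop (𝓝 η)) :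
    ∃ uh : Ω' → Coef p,
      (∀ ω, IsArgmin (pinned Finset.univ 0) (penalizedQuad C (W ω) Finset.univ fun j =>
        limitPenalty (βs j) (if βs j = 0 then l / |z ω j| ^ γ₁ else 0) (η * |βs j| ^ γ₂)
          (√r₀ * z ω j)) (uh ω)) ∧
      TendstoInDistribution (fun (n : ℕ) ω => √(n : ℝ) • (βh n ω - βs)) atTop uh
        (fun _ => P) P' := by
  have hl0 : 0 ≤ l :=
    ge_of_tendsto' hlam fun n => mul_nonneg (Real.sqrt_nonneg _) (M.lam_nonneg n)
  have hη0 : 0 ≤ η :=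
    ge_of_tendsto' heta fun n => div_nonneg (M.eta_nonneg n) (Real.sqrt_nonneg _)
  have hzm := M.aemeasurable_initial_limit
  refine M.exists_isArgmin_tendstoInDistribution (fun n => √(n : ℝ)) Finset.univ
    (A := fun ω j => if βs j = 0 then l / |z ω j| ^ γ₁ else 0) (B := fun _ j => η * |βs j| ^ γ₂)
    (d := fun ω j => √r₀ * z ω j) (c := fun _ => 0) (aemeasurable_pi_lambda _ fun j => ?_)
    (by fun_prop) (by fun_prop) M.aemeasurable_score_limit (by fun_prop)
    (fun ω j => ?_) (fun _ j => by positivity) ?_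
  · split_ifs <;> fun_prop
  · dsimp only
    split_ifs <;> positivity
  · filter_upwards [ae_forall_ne_zero_or M.gamma₁_nonneg hz] with ω hω k e bt bh u H hu
    exact H.tendsto_sqrt_size_smul_sub_of_free hl hω (hlam.comp H.tendsto_size)
      (heta.comp H.tendsto_size) hu

theorem tendstoInDistribution_sqrt_size_smul_sub_of_active_pinned
    (hz : 0 < γ₁ → ∀ j ∉ active βs, ∀ᵐ ω ∂P', z ω j ≠ 0)
    (hlam : Tendsto (fun n : ℕ => √((m n : ℝ) ^ γ₁ / n) * lam n) atTop (𝓝 l))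
    (heta : Tendsto (fun n : ℕ => eta n / √(n : ℝ)) atTop atTop)
    (heta_inactive : Tendsto (fun n : ℕ => eta n / √(n * (m n : ℝ) ^ γ₂)) atTop (𝓝 η)) :
    ∃ uh : Ω' → Coef p,
      (∀ ω, IsArgmin (pinned (active βs)ᶜ (WithLp.toLp 2 fun j => √r₀ * z ω j))
        (penalizedQuad C (W ω) (active βs)ᶜ fun j =>
          limitPenalty (βs j) (l / |z ω j| ^ γ₁) (η * |z ω j| ^ γ₂) (√r₀ * z ω j)) (uh ω)) ∧
      TendstoInDistribution (fun (n : ℕ) ω => √(n : ℝ) • (βh n ω - βs)) atTop uh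
        (fun _ => P) P' := by
  have hl0 : 0 ≤ l :=
    ge_of_tendsto' hlam fun n => mul_nonneg (Real.sqrt_nonneg _) (M.lam_nonneg n)
  have hη0 : 0 ≤ η :=
    ge_of_tendsto' heta_inactive fun n => div_nonneg (M.eta_nonneg n) (Real.sqrt_nonneg _)
  have hzm := M.aemeasurable_initial_limit
  refine M.exists_isArgmin_tendstoInDistribution (fun n => √(n : ℝ)) (active βs)ᶜ
    (A := fun ω j => l / |z ω j| ^ γ₁) (B := fun ω j => η * |z ω j| ^ γ₂)
    (d := fun ω j => √r₀ * z ω j) (c := fun ω => WithLp.toLp 2 fun j => √r₀ * z ω j)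
    (by fun_prop) (by fun_prop) (by fun_prop) M.aemeasurable_score_limit (by fun_prop)
    (fun ω j => by positivity) (fun ω j => by positivity) ?_
  filter_upwards [ae_forall_ne_zero_or M.gamma₁_nonneg hz] with ω hω k e bt bh u H hu
  exact H.tendsto_sqrt_size_smul_sub_of_active_pinned hω (hlam.comp H.tendsto_size)
    (heta.comp H.tendsto_size) (heta_inactive.comp H.tendsto_size) hu

theorem tendstoInDistribution_sqrt_size_smul_sub_of_inactive_pinned
    (hlam_inactive : Tendsto (fun n : ℕ => √((m n : ℝ) ^ γ₁ / n) * lam n) atTop atTop)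
    (hlam : Tendsto (fun n : ℕ => lam n / √(n : ℝ)) atTop (𝓝 l))
    (heta : Tendsto (fun n : ℕ => eta n / √(n : ℝ)) atTop (𝓝 η)) :
    ∃ uh : Ω' → Coef p,
      (∀ ω, IsArgmin (pinned (active βs) 0) (penalizedQuad C (W ω) (active βs) fun j =>
        limitPenalty (βs j) (l / |βs j| ^ γ₁) (η * |βs j| ^ γ₂) (√r₀ * z ω j)) (uh ω)) ∧
      TendstoInDistribution (fun (n : ℕ) ω => √(n : ℝ) • (βh n ω - βs)) atTop uh
        (fun _ => P) P' := by
  have hl0 : 0 ≤ l :=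
    ge_of_tendsto' hlam fun n => div_nonneg (M.lam_nonneg n) (Real.sqrt_nonneg _)
  have hη0 : 0 ≤ η :=
    ge_of_tendsto' heta fun n => div_nonneg (M.eta_nonneg n) (Real.sqrt_nonneg _)
  have hzm := M.aemeasurable_initial_limit
  refine M.exists_isArgmin_tendstoInDistribution (fun n => √(n : ℝ)) (active βs)
    (A := fun _ j => l / |βs j| ^ γ₁) (B := fun _ j => η * |βs j| ^ γ₂)
    (d := fun ω j => √r₀ * z ω j) (c := fun _ => 0) (by fun_prop) (by fun_prop) (by fun_prop)
    M.aemeasurable_score_limit (by fun_prop) (fun _ j => by positivity)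
    (fun _ j => by positivity) ?_
  refine Eventually.of_forall fun ω k e bt bh u H hu => ?_
  exact H.tendsto_sqrt_size_smul_sub_of_inactive_pinned (hlam_inactive.comp H.tendsto_size)
    (hlam.comp H.tendsto_size) (heta.comp H.tendsto_size) hu

theorem tendstoInDistribution_size_div_smul_sub_of_inactive_pinned (hγ₁ : 0 < γ₁)
    (hlam : Tendsto (fun n : ℕ => lam n / √(n : ℝ)) atTop atTop)
    (hlam_zero : Tendsto (fun n : ℕ => lam n / n) atTop (𝓝 0))
    (heta : Tendsto (fun n : ℕ => eta n / lam n) atTop (𝓝 0)) :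
    ∃ u₀ : Coef p,
      IsArgmin (pinned (active βs) 0) (penalizedQuad C 0 (active βs) fun j =>
        limitPenalty (βs j) (1 / |βs j| ^ γ₁) 0 0) u₀ ∧
      TendstoInDistribution (fun (n : ℕ) ω => ((n : ℝ) / lam n) • (βh n ω - βs)) atTop
        (fun _ => u₀) (fun _ => P) P' := by
  obtain ⟨g, -, hg⟩ := exists_continuous_isArgmin (Q := Unit) M.posDef (active βs) βs
    (A := fun _ j => 1 / |βs j| ^ γ₁) (B := 0) (d := 0) (w := 0) (c := 0)
    continuous_const continuous_const continuous_const continuous_const continuous_const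
    (fun _ j => by positivity) fun _ => le_rfl
  refine ⟨g (), hg (), M.tendstoInDistribution_of_forall_realization _ aemeasurable_const ?_⟩
  refine Eventually.of_forall fun ω k e bt bh H => ?_
  exact H.tendsto_size_div_smul_sub_of_inactive_pinned hγ₁ (hlam.comp H.tendsto_size)
    (hlam_zero.comp H.tendsto_size) (heta.comp H.tendsto_size) (hg ())

end IsEstimateModel

theorem tendstoInDistribution_initial_score {Ω Ω' : Type*} [MeasurableSpace Ω] [MeasurableSpace Ω']
    {P : Measure Ω} [IsProbabilityMeasure P] {P' : Measure Ω'} [IsProbabilityMeasure P']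
    {p : ℕ} {βs : Coef p} {σ : ℝ≥0} {X : (n : ℕ) → Matrix (Fin n) (Fin p) ℝ}
    {C : Matrix (Fin p) (Fin p) ℝ} {ε : (n : ℕ) → Fin n → Ω → ℝ} {m : ℕ → ℕ}
    {βt : ℕ → Ω → Coef p} {z W : Ω' → Coef p} (hC : C.PosSemidef)
    (hXC : Tendsto (fun n => gram (X n)) atTop (𝓝 C))
    (hε : ∀ n i, HasLaw (ε n i) (gaussianReal 0 (σ ^ 2)) P) (hεindep : ∀ n, iIndepFun (ε n) P)
    (hβtε : ∀ n, IndepFun (βt n) (fun ω i => ε n i ω) P)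
    (hz : TendstoInDistribution (fun n ω => √(m n : ℝ) • (βt n ω - βs)) atTop z (fun _ => P) P')
    (hW : HasLaw W (multivariateGaussian 0 ((σ : ℝ) ^ 2 • C)) P') (hzW : IndepFun z W P') :
    TendstoInDistribution
      (fun n ω => (√(m n : ℝ) • (βt n ω - βs), score (X n) fun i => ε n i ω)) atTop
      (fun ω => (z ω, W ω)) (fun _ => P) P' :=
  tendstoInDistribution_prodMk_of_indepFun hz
    (tendstoInDistribution_score hC hXC hε hεindep hW)
    (fun n => (hβtε n).comp (φ := fun b => √(m n : ℝ) • (b - βs)) (by fun_prop)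
      (measurable_score (X n))) hzW

end AdaptiveTransferLasso

theorem mainTheorem1_general
    {Ω Ω' : Type*} [MeasurableSpace Ω] [MeasurableSpace Ω']
    {P : Measure Ω} [IsProbabilityMeasure P] {P' : Measure Ω'} [IsProbabilityMeasure P']
    {p : ℕ} {βs : Coef p} {γ₁ γ₂ r₀ : ℝ} {C : Matrix (Fin p) (Fin p) ℝ} {z W : Ω' → Coef p}
    {m : ℕ → ℕ} {X : (n : ℕ) → Matrix (Fin n) (Fin p) ℝ} {ε : (n : ℕ) → Fin n → Ω → ℝ}
    {lam eta : ℕ → ℝ} {βt βh : ℕ → Ω → Coef p}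
    (M : IsEstimateModel P P' βs γ₁ γ₂ r₀ C z W m X ε lam eta βt βh) :
    ((0 < γ₂ → ∀ j ∉ active βs, ∀ᵐ ω ∂P', z ω j ≠ 0) →
      Tendsto (fun n : ℕ => eta n / √(n * (m n : ℝ) ^ γ₂)) atTop atTop →
      Tendsto (fun n : ℕ => √((m n : ℝ) ^ (γ₁ + γ₂)) * lam n / eta n) atTop (𝓝 0) →
      TendstoInDistribution (fun n ω => √(m n : ℝ) • (βh n ω - βs)) atTop z (fun _ => P) P') ∧
    (Tendsto (fun n : ℕ => √((m n : ℝ) ^ γ₁ / n) * lam n) atTop atTop →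
      Tendsto (fun n : ℕ => eta n / √(n : ℝ)) atTop atTop →
      Tendsto (fun n : ℕ => eta n / lam n) atTop atTop →
      Tendsto (fun n : ℕ => eta n / (√((m n : ℝ) ^ (γ₁ + γ₂)) * lam n)) atTop (𝓝 0) →
      TendstoInDistribution (fun n ω => √(m n : ℝ) • (βh n ω - βs)) atTop
        (fun ω => WithLp.toLp 2 (fun j => if j ∈ active βs then z ω j else 0))
        (fun _ => P) P') ∧
    (∀ lam₁ eta₀ : ℝ,
      (γ₁ = 0 → lam₁ = 0) → (γ₂ = 0 → eta₀ = 0) →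
      (0 < γ₁ → ∀ j ∉ active βs, ∀ᵐ ω ∂P', z ω j ≠ 0) →
      Tendsto (fun n : ℕ => √((m n : ℝ) ^ γ₁ / n) * lam n) atTop (𝓝 lam₁) →
      Tendsto (fun n : ℕ => eta n / √(n : ℝ)) atTop (𝓝 eta₀) →
      ∃ uh : Ω' → Coef p,
        (∀ᵐ ω ∂P', IsArgmin Set.univ
          (fun u => quad C u - 2 * (u.ofLp ⬝ᵥ (W ω).ofLp)
            + ∑ j ∈ (active βs)ᶜ, lam₁ / |z ω j| ^ γ₁ * |u j|
            + ∑ j ∈ active βs, eta₀ * |βs j| ^ γ₂ * |u j - √r₀ * z ω j|) (uh ω)) ∧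
        TendstoInDistribution (fun (n : ℕ) ω => √(n : ℝ) • (βh n ω - βs)) atTop uh
          (fun _ => P) P') ∧
    (∀ lam₁ eta₁ : ℝ,
      (0 < γ₁ → ∀ j ∉ active βs, ∀ᵐ ω ∂P', z ω j ≠ 0) →
      Tendsto (fun n : ℕ => √((m n : ℝ) ^ γ₁ / n) * lam n) atTop (𝓝 lam₁) →
      Tendsto (fun n : ℕ => eta n / √(n : ℝ)) atTop atTop →
      Tendsto (fun n : ℕ => eta n / √(n * (m n : ℝ) ^ γ₂)) atTop (𝓝 eta₁) →
      ∃ uh : Ω' → Coef p,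
        (∀ᵐ ω ∂P', IsArgmin {u | ∀ j ∈ active βs, u j = √r₀ * z ω j}
          (fun u => quad C u - 2 * (u.ofLp ⬝ᵥ (W ω).ofLp)
            + ∑ j ∈ (active βs)ᶜ, (lam₁ / |z ω j| ^ γ₁ * |u j|
              + eta₁ * |z ω j| ^ γ₂ * |u j - √r₀ * z ω j|)) (uh ω)) ∧
        TendstoInDistribution (fun (n : ℕ) ω => √(n : ℝ) • (βh n ω - βs)) atTop uh
          (fun _ => P) P') ∧
    (∀ lam₀ eta₀ : ℝ,
      Tendsto (fun n : ℕ => √((m n : ℝ) ^ γ₁ / n) * lam n) atTop atTop →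
      Tendsto (fun n : ℕ => lam n / √(n : ℝ)) atTop (𝓝 lam₀) →
      Tendsto (fun n : ℕ => eta n / √(n : ℝ)) atTop (𝓝 eta₀) →
      ∃ uh : Ω' → Coef p,
        (∀ᵐ ω ∂P', IsArgmin {u | ∀ j ∉ active βs, u j = 0}
          (fun u => quad C u - 2 * (u.ofLp ⬝ᵥ (W ω).ofLp)
            + ∑ j ∈ active βs, (lam₀ * (SignType.sign (βs j) / |βs j| ^ γ₁) * u j
              + eta₀ * |βs j| ^ γ₂ * |u j - √r₀ * z ω j|)) (uh ω)) ∧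
        TendstoInDistribution (fun (n : ℕ) ω => √(n : ℝ) • (βh n ω - βs)) atTop uh
          (fun _ => P) P') ∧
    (0 < γ₁ →
      Tendsto (fun n : ℕ => lam n / √(n : ℝ)) atTop atTop →
      Tendsto (fun n : ℕ => lam n / n) atTop (𝓝 0) →
      Tendsto (fun n : ℕ => eta n / lam n) atTop (𝓝 0) →
      ∃ u₀ : Coef p,
        IsArgmin {u | ∀ j ∉ active βs, u j = 0}
          (fun u => quad C u
            + ∑ j ∈ active βs, SignType.sign (βs j) / |βs j| ^ γ₁ * u j) u₀ ∧
        TendstoInDistribution (fun (n : ℕ) ω => ((n : ℝ) / lam n) • (βh n ω - βs)) atTop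
          (fun _ : Ω' => u₀) (fun _ => P) P') := by
  refine ⟨M.tendstoInDistribution_sqrt_source_smul_sub_of_transfer,
    fun hlam heta hratio hratio_source => ?_, fun l η hl hη hz hlam heta => ?_,
    fun l η hz hlam heta heta_inactive => ?_, fun l η hlam_inactive hlam heta => ?_,
    fun hγ₁ hlam hlam_zero heta => ?_⟩
  · simpa only [mem_active, ite_not] using
      M.tendstoInDistribution_sqrt_source_smul_sub_of_pinned hlam heta hratio hratio_source
  · obtain ⟨uh, hmin, hlim⟩ :=
      M.tendstoInDistribution_sqrt_size_smul_sub_of_free hl hz hlam heta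
    refine ⟨uh, Eventually.of_forall fun ω => ?_, hlim⟩
    simpa only [pinned_univ, penalizedQuad_free _ _ _ _ _ _ _ hη] using hmin ω
  · obtain ⟨uh, hmin, hlim⟩ :=
      M.tendstoInDistribution_sqrt_size_smul_sub_of_active_pinned hz hlam heta heta_inactive
    refine ⟨uh, Eventually.of_forall fun ω => ?_, hlim⟩
    simpa only [pinned_compl, penalizedQuad_active_compl] using hmin ω
  · obtain ⟨uh, hmin, hlim⟩ :=
      M.tendstoInDistribution_sqrt_size_smul_sub_of_inactive_pinned hlam_inactive hlam heta
    refine ⟨uh, Eventually.of_forall fun ω => ?_, hlim⟩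
    simpa only [pinned, PiLp.zero_apply, penalizedQuad_active] using hmin ω
  · obtain ⟨u₀, hmin, hlim⟩ :=
      M.tendstoInDistribution_size_div_smul_sub_of_inactive_pinned hγ₁ hlam hlam_zero heta
    refine ⟨u₀, ?_, hlim⟩
    simpa only [pinned, PiLp.zero_apply, penalizedQuad_active, WithLp.ofLp_zero, dotProduct_zero,
      mul_zero, sub_zero, one_mul, zero_mul, add_zero] using hmin

theorem mainTheorem1
    {Ω Ω' : Type*} [MeasurableSpace Ω] [MeasurableSpace Ω']
    (P : Measure Ω) [IsProbabilityMeasure P] (P' : Measure Ω') [IsProbabilityMeasure P']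
    {p : ℕ} (βs : Coef p) (σ : ℝ≥0) (γ₁ γ₂ : ℝ) (hγ₁ : 0 ≤ γ₁) (hγ₂ : 0 ≤ γ₂)
    -- the designs and their limit
    (X : (n : ℕ) → Matrix (Fin n) (Fin p) ℝ) (C : Matrix (Fin p) (Fin p) ℝ) (hC : C.PosDef)
    (hXC : Tendsto (fun n : ℕ => (1 / n : ℝ) • ((X n)ᵀ * X n)) atTop (𝓝 C))
    (hXmax : Tendsto (fun n : ℕ => (1 / n : ℝ) * ⨆ i : Fin n, ‖WithLp.toLp 2 (X n i)‖ ^ 2)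
      atTop (𝓝 0))
    -- i.i.d. Gaussian noise
    (ε : (n : ℕ) → Fin n → Ω → ℝ)
    (hε : ∀ n i, HasLaw (ε n i) (gaussianReal 0 (σ ^ 2)) P)
    (hεindep : ∀ n, iIndepFun (ε n) P)
    -- source sample sizes and the initial estimator
    (m : ℕ → ℕ) (hm : ∀ᶠ n in atTop, 0 < m n)
    (r₀ : ℝ) (hr₀ : Tendsto (fun n : ℕ => (n : ℝ) / m n) atTop (𝓝 r₀))
    (βt : ℕ → Ω → Coef p) (hβt : ∀ n, AEMeasurable (βt n) P)
    (hβtε : ∀ n, IndepFun (βt n) (fun ω i => ε n i ω) P)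
    -- the limit `z` of the initial estimator and the Gaussian vector `W`
    (z W : Ω' → Coef p)
    (hz : TendstoInDistribution (fun n ω => √(m n : ℝ) • (βt n ω - βs)) atTop z (fun _ => P) P')
    (hW : HasLaw W (multivariateGaussian 0 ((σ : ℝ) ^ 2 • C)) P')
    (hzW : IndepFun z W P')
    -- the tuning parameters and the estimator
    (lam eta : ℕ → ℝ) (hlam : ∀ n, 0 ≤ lam n) (heta : ∀ n, 0 ≤ eta n)
    (βh : ℕ → Ω → Coef p) (hβh : ∀ n, AEMeasurable (βh n) P)
    (hmin : ∀ n, ∀ᵐ ω ∂P, IsEstimate (X n) (response (X n) βs (fun i => ε n i ω)) (βt n ω)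
      (lam n) (eta n) γ₁ γ₂ (βh n ω)) :
    -- (i)
    ((0 < γ₂ → ∀ j ∉ active βs, ∀ᵐ ω ∂P', z ω j ≠ 0) →
      Tendsto (fun n : ℕ => eta n / √(n * (m n : ℝ) ^ γ₂)) atTop atTop →
      Tendsto (fun n : ℕ => √((m n : ℝ) ^ (γ₁ + γ₂)) * lam n / eta n) atTop (𝓝 0) →
      TendstoInDistribution (fun n ω => √(m n : ℝ) • (βh n ω - βs)) atTop z (fun _ => P) P')
    ∧
    -- (ii)
    (∀ ρ₀ : ℝ≥0∞,
      Tendsto (fun n : ℕ => √((m n : ℝ) ^ γ₁ / n) * lam n) atTop atTop →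
      Tendsto (fun n : ℕ => eta n / √(n : ℝ)) atTop atTop →
      Tendsto (fun n : ℕ => eta n / lam n) atTop atTop →
      Tendsto (fun n : ℕ => eta n / (√((m n : ℝ) ^ (γ₁ + γ₂)) * lam n)) atTop (𝓝 0) →
      Tendsto (fun n : ℕ => ENNReal.ofReal (√((m n : ℝ) ^ γ₁) * lam n / eta n)) atTop (𝓝 ρ₀) →
      TendstoInDistribution (fun n ω => √(m n : ℝ) • (βh n ω - βs)) atTop
        (fun ω => WithLp.toLp 2 (fun j => if j ∈ active βs then z ω j else 0))
        (fun _ => P) P')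
    ∧
    -- (iii)
    (∀ lam₁ eta₀ : ℝ,
      (γ₁ = 0 → lam₁ = 0) → (γ₂ = 0 → eta₀ = 0) →
      (0 < γ₁ → ∀ j ∉ active βs, ∀ᵐ ω ∂P', z ω j ≠ 0) →
      Tendsto (fun n : ℕ => √((m n : ℝ) ^ γ₁ / n) * lam n) atTop (𝓝 lam₁) →
      Tendsto (fun n : ℕ => eta n / √(n : ℝ)) atTop (𝓝 eta₀) →
      ∃ uh : Ω' → Coef p,
        (∀ᵐ ω ∂P', IsArgmin Set.univ
          (fun u => quad C u - 2 * (u.ofLp ⬝ᵥ (W ω).ofLp)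
            + ∑ j ∈ (active βs)ᶜ, lam₁ / |z ω j| ^ γ₁ * |u j|
            + ∑ j ∈ active βs, eta₀ * |βs j| ^ γ₂ * |u j - √r₀ * z ω j|) (uh ω)) ∧
        TendstoInDistribution (fun (n : ℕ) ω => √(n : ℝ) • (βh n ω - βs)) atTop uh (fun _ => P) P')
    ∧
    -- (iv)
    (∀ lam₁ eta₁ : ℝ,
      (0 < γ₁ → ∀ j ∉ active βs, ∀ᵐ ω ∂P', z ω j ≠ 0) →
      Tendsto (fun n : ℕ => √((m n : ℝ) ^ γ₁ / n) * lam n) atTop (𝓝 lam₁) →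
      Tendsto (fun n : ℕ => eta n / √(n : ℝ)) atTop atTop →
      Tendsto (fun n : ℕ => eta n / √(n * (m n : ℝ) ^ γ₂)) atTop (𝓝 eta₁) →
      ∃ uh : Ω' → Coef p,
        (∀ᵐ ω ∂P', IsArgmin {u | ∀ j ∈ active βs, u j = √r₀ * z ω j}
          (fun u => quad C u - 2 * (u.ofLp ⬝ᵥ (W ω).ofLp)
            + ∑ j ∈ (active βs)ᶜ, (lam₁ / |z ω j| ^ γ₁ * |u j|
              + eta₁ * |z ω j| ^ γ₂ * |u j - √r₀ * z ω j|)) (uh ω)) ∧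
        TendstoInDistribution (fun (n : ℕ) ω => √(n : ℝ) • (βh n ω - βs)) atTop uh (fun _ => P) P')
    ∧
    -- (v)
    (∀ lam₀ eta₀ : ℝ,
      Tendsto (fun n : ℕ => √((m n : ℝ) ^ γ₁ / n) * lam n) atTop atTop →
      Tendsto (fun n : ℕ => lam n / √(n : ℝ)) atTop (𝓝 lam₀) →
      Tendsto (fun n : ℕ => eta n / √(n : ℝ)) atTop (𝓝 eta₀) →
      ∃ uh : Ω' → Coef p,
        (∀ᵐ ω ∂P', IsArgmin {u | ∀ j ∉ active βs, u j = 0}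
          (fun u => quad C u - 2 * (u.ofLp ⬝ᵥ (W ω).ofLp)
            + ∑ j ∈ active βs, (lam₀ * (SignType.sign (βs j) / |βs j| ^ γ₁) * u j
              + eta₀ * |βs j| ^ γ₂ * |u j - √r₀ * z ω j|)) (uh ω)) ∧
        TendstoInDistribution (fun (n : ℕ) ω => √(n : ℝ) • (βh n ω - βs)) atTop uh (fun _ => P) P')
    ∧
    -- (vi)
    (0 < γ₁ →
      Tendsto (fun n : ℕ => lam n / √(n : ℝ)) atTop atTop →
      Tendsto (fun n : ℕ => lam n / n) atTop (𝓝 0) →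
      Tendsto (fun n : ℕ => eta n / lam n) atTop (𝓝 0) →
      ∃ u₀ : Coef p,
        IsArgmin {u | ∀ j ∉ active βs, u j = 0}
          (fun u => quad C u
            + ∑ j ∈ active βs, SignType.sign (βs j) / |βs j| ^ γ₁ * u j) u₀ ∧
        TendstoInDistribution (fun (n : ℕ) ω => ((n : ℝ) / lam n) • (βh n ω - βs)) atTop
          (fun _ : Ω' => u₀) (fun _ => P) P') := by
  obtain ⟨h₁, h₂, h₃⟩ := mainTheorem1_general ⟨hC, hγ₁, hγ₂, hm, hr₀, hXC,
    tendstoInDistribution_initial_score hC.posSemidef hXC hε hεindep hβtε hz hW hzW,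
    hlam, heta, hβh, hmin⟩
  exact ⟨h₁, fun _ hlam heta hratio hratio_source _ => h₂ hlam heta hratio hratio_source, h₃⟩
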